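/- Let $n\ge 4$ and $1\le k\le n-1$. For points of the real projective plane $\mathbf{RP}^2$ write $(ab)(cd)$ for the intersection of the lines $(ab)$ and $(cd)$. **Seeds.** A seed of type $(n,k)$ consists of the consecutive vertices $A_1,\dots,A_n$ of a strictly convex $n$-gon in $\mathbf{RP}^2$ (the image under a projective transformation of a strictly convex polygon of $\mathbf R^2$) and of one point $B_j$ in the interior of each edge $A_jA_{j+1}$, $j=n-k+1,\dots,n$ (indices mod $n$). The seed map sends it to the seed $(A^*,B^*)$ with $A_i^*=A_{i+1}$ for $1\le i\le n-k$; $A_i^*=B_i$ for $n-k+1\le i\le n$; $B_n^*=(A_1A_2^*)(A_n^*A_1^*)$; and $B_j^*=(A_{j+1}B_{j+1}^*)(A_j^*A_{j+1}^*)$ for $j=n-1,\dots,n-k+1$, in this order. **Spirals.** The pentagram map $T$ sends a bi-infinite polygonal path $P=(P_q)_{q\in\mathbf Z}$ in $\mathbf{RP}^2$ to the path $T(P)$ with vertices $T(P)_q=(P_{q-1}P_{q+1})(P_qP_{q+2})$, the points where consecutive shortest diagonals cross; its edges lie in these diagonals. A labeled PLC (properly locally convex) pentagram spiral of type $(n,k)$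 is a bi-infinite polygonal path $P$ such that * $T^j(P)$ is defined for $0\le j\le k$, and $T^k(P)_q=P_{q+n+k}$ for all $q$, with the same edges; * the paths $P,T(P),\dots,T^{k-1}(P)$ are strictly locally convex, embedded and pairwise disjoint (so $k$ is the least positive exponent for which $T^k(P)=P$ as unlabeled paths); * $P$ is generated by a seed: there are seeds $S_q$ $(q\in\mathbf Z)$ of type $(n,k)$, each $S_{q+1}$ being the image of $S_q$ under the seed map, such that $P_q$ is the first vertex $A_1$ of $S_q$. **The space.** Let $\mathcal C(n,k)$ be the space of labeled PLC pentagram spirals of type $(n,k)$ modulo projective transformations, with the quotient of the topology of pointwise convergence of vertices. Let $T_{n,k}:\mathcal C(n,k)\to\mathcal C(n,k)$ be the bijection induced by the shift $(P_q)_q\mapsto(P_{q+1})_q$, which moves the distinguished vertex one step inwards. **Theorem.** Every orbit $\{T_{n,k}^m(c): m\in\mathbf Z\}$, $c\in\mathcal C(n,k)$, has compact closure in $\mathcal C(n,k)$. -/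

import Mathlib

open scoped LinearAlgebra.Projectivization

noncomputable section

/-! ### The real projective plane -/

/-- The real projective plane: lines through the origin of `ℝ³`. -/
abbrev RP2 : Type := ℙ ℝ (Fin 3 → ℝ)

/-- The usual (quotient) topology of the projective plane. -/
instance RP2.instTopologicalSpace : TopologicalSpace RP2 :=
  TopologicalSpace.coinduced
    (fun v : {v : Fin 3 → ℝ // v ≠ 0} => Projectivization.mk ℝ v.1 v.2) inferInstance

/-- Projective transformations, given by invertible linear maps of `ℝ³`; they act on `RP2`
through Mathlib's action `g • x`. -/
abbrev ProjTrans : Type := (Fin 3 → ℝ) ≃ₗ[ℝ] (Fin 3 → ℝ)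

/-- The intersection point `(ab)(cd)` of the line through `a, b` with the line through `c, d`
(in homogeneous coordinates, joins and meets are both cross products). It is meaningful if
`a ≠ b`, `c ≠ d` and the two lines are distinct. -/
def meet (a b c d : RP2) : RP2 :=
  Projectivization.cross (Projectivization.cross a b) (Projectivization.cross c d)

/-- The inclusion `(x, y) ↦ [x : y : 1]` of the affine plane. -/
def affinePt (p : ℝ × ℝ) : RP2 :=
  Projectivization.mk ℝ ![p.1, p.2, 1] (fun h => one_ne_zero (congrFun h 2))

/-! ### Seeds and the seed map -/

/-- Twice the signed area of the triangle `p q r`; it is positive iff `p, q, r` is a nondegenerate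
counterclockwise triangle. -/
def orient (p q r : ℝ × ℝ) : ℝ :=
  (q.1 - p.1) * (r.2 - p.2) - (q.2 - p.2) * (r.1 - p.1)

/-- The points of a seed of type `(n, k)`: the vertices `A 1, …, A n` and the additional points
`B (n - k + 1), …, B n`. The values at other indices play no role. -/
structure SeedPoints where
  /-- the vertices `A₁, …, Aₙ` -/
  A : ℕ → RP2
  /-- the points `Bₙ₋ₖ₊₁, …, Bₙ` -/
  B : ℕ → RP2

/-- `S` is a seed of type `(n, k)`: after a projective transformation, `A 1, …, A n` are
the consecutive vertices of a strictly convex polygon of the affine plane (counterclockwise, which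
a reflection always achieves), and `B j` is an interior point of the edge from `A j` to
`A (j + 1)`, indices mod `n`, for each `j = n - k + 1, …, n`. -/
def IsSeed (n k : ℕ) (S : SeedPoints) : Prop :=
  ∃ (g : ProjTrans) (a b : ℕ → ℝ × ℝ),
    (∀ i, 1 ≤ i → i ≤ n → g • S.A i = affinePt (a i)) ∧
    (∀ j, n < j + k → j ≤ n → g • S.B j = affinePt (b j)) ∧
    (∀ i j l, 1 ≤ i → i < j → j < l → l ≤ n → 0 < orient (a i) (a j) (a l)) ∧
    (∀ j, n < j + k → j ≤ n → b j ∈ openSegment ℝ (a j) (a (j % n + 1)))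

/-- `S'` is the image of the seed `S` under the seed map of type `(n, k)`. The points `S'.B j` are
constructed from the largest index to the smallest, so `S'` is determined by `S`. -/
structure IsSeedMap (n k : ℕ) (S S' : SeedPoints) : Prop where
  A_first : ∀ i, 1 ≤ i → i + k ≤ n → S'.A i = S.A (i + 1)
  A_last : ∀ i, n < i + k → i ≤ n → S'.A i = S.B i
  B_top : S'.B n = meet (S.A 1) (S'.A 2) (S'.A n) (S'.A 1)
  B_next : ∀ j, n < j + k → j < n →
    S'.B j = meet (S.A (j + 1)) (S'.B (j + 1)) (S'.A j) (S'.A (j + 1))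

/-- The bi-infinite path `P` is generated by a seed of type `(n, k)`: it consists of the first
vertices of the seeds in a bi-infinite orbit of the seed map. -/
def IsGeneratedBySeed (n k : ℕ) (P : ℤ → RP2) : Prop :=
  ∃ S : ℤ → SeedPoints, (∀ q, IsSeed n k (S q)) ∧ (∀ q, IsSeedMap n k (S q) (S (q + 1))) ∧
    ∀ q, P q = (S q).A 1

/-! ### Bi-infinite polygonal paths and PLC pentagram spirals

A bi-infinite polygonal path in the projective plane, with its edges, is encoded by a sequence
`v : ℤ → ℝ³`: the vertices are the points `[v q]`, and the edge from `[v q]` to `[v (q + 1)]` is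
the one of the two projective segments that consists of the points `[s v q + t v (q + 1)]` with
`s, t ≥ 0`. Every path with chosen edges arises so, and `v` is unique up to positive factors at
the vertices and one common sign. -/

/-- The edge from `[v q]` to `[v (q + 1)]`, without its endpoint `[v (q + 1)]`. -/
def halfOpenEdge (v : ℤ → Fin 3 → ℝ) (q : ℤ) : Set RP2 :=
  {x | ∃ s t : ℝ, 0 < s ∧ 0 ≤ t ∧ ∃ h : s • v q + t • v (q + 1) ≠ 0,
    x = Projectivization.mk ℝ (s • v q + t • v (q + 1)) h}

/-- The path is (strictly) locally convex: it turns in the same direction at all vertices. -/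
def IsLocallyConvex (v : ℤ → Fin 3 → ℝ) : Prop :=
  ∀ q, 0 < Matrix.det ![v q, v (q + 1), v (q + 2)]

/-- `x` represents an interior point of the segment between the points of `u` and `w`. -/
def InOpenCone (u w x : Fin 3 → ℝ) : Prop :=
  ∃ s t : ℝ, 0 < s ∧ 0 < t ∧ x = s • u + t • w

/-- The path of `w` is the image of the path of `v` under the pentagram map: the vertex `q` of the
new path is the point where the shortest diagonals from `q - 1` to `q + 1` and from `q` to `q + 2`
of the old one cross, and the edges of the new path lie in these diagonals. -/
def IsPentagramImage (v w : ℤ → Fin 3 → ℝ) : Prop :=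
  ∀ q, InOpenCone (v (q - 1)) (v (q + 1)) (w q) ∧ InOpenCone (v q) (v (q + 2)) (w q)

/-- `P` is the sequence of vertices of a PLC (properly locally convex) pentagram spiral of type
`(n, k)`. Here `u j` is the path `T^j(P)`, for the pentagram map `T`.

* `T^k(P) = P` as unlabeled paths, the labels being shifted by `n + k` (the vertex `q` of the
  image under `T` sits half a step beyond the vertex `q` of the path, so this is the shift by
  `μ = n + k / 2` in symmetric labels, and the integers increase inwards).
* The paths `P, T(P), …, T^(k-1)(P)` are locally convex, embedded and pairwise disjoint; in
  particular `k` is the smallest positive exponent with `T^k(P) = P`. -/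
def IsPLCSpiral (n k : ℕ) (P : ℤ → RP2) : Prop :=
  ∃ u : ℕ → ℤ → Fin 3 → ℝ,
    (∀ q, ∃ h : u 0 q ≠ 0, P q = Projectivization.mk ℝ (u 0 q) h) ∧
    (∀ j < k, IsPentagramImage (u j) (u (j + 1))) ∧
    (∀ q, ∃ c : ℝ, 0 < c ∧ u k q = c • u 0 (q + n + k)) ∧
    (∀ j < k, IsLocallyConvex (u j)) ∧
    (∀ j < k, ∀ j' < k, ∀ q q' : ℤ, (j, q) ≠ (j', q') →
      Disjoint (halfOpenEdge (u j) q) (halfOpenEdge (u j') q'))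

/-! ### The space `C(n, k)` and the shift map -/

/-- Labeled PLC pentagram spirals of type `(n, k)` (generated by a seed), with the topology of
pointwise convergence of the vertices. -/
abbrev LabeledSpiral (n k : ℕ) : Type :=
  {P : ℤ → RP2 // IsPLCSpiral n k P ∧ IsGeneratedBySeed n k P}

/-- Two labeled spirals are equivalent if a projective transformation carries one to the other,
respecting the labels. -/
instance spiralSetoid (n k : ℕ) : Setoid (LabeledSpiral n k) where
  r P Q := ∃ g : ProjTrans, ∀ q, g • P.1 q = Q.1 q
  iseqv :=
    { refl := fun _ => ⟨1, fun _ => one_smul _ _⟩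
      symm := fun ⟨g, h⟩ => ⟨g⁻¹, fun q => by rw [← h q, inv_smul_smul]⟩
      trans := fun ⟨g, h⟩ ⟨g', h'⟩ => ⟨g' * g, fun q => by rw [mul_smul, h q, h' q]⟩ }

/-- The space `C(n, k)` of projective equivalence classes of labeled PLC pentagram spirals of type
`(n, k)`, with the quotient topology. -/
abbrev SpiralSpace (n k : ℕ) : Type := Quotient (spiralSetoid n k)

theorem IsGeneratedBySeed.shift {n k : ℕ} {P : ℤ → RP2} (h : IsGeneratedBySeed n k P) (m : ℤ) :
    IsGeneratedBySeed n k (fun q => P (q + m)) := by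
  obtain ⟨S, h1, h2, h3⟩ := h
  refine ⟨fun q => S (q + m), fun q => h1 _, fun q => ?_, fun q => h3 _⟩
  have := h2 (q + m)
  rwa [show q + m + 1 = q + 1 + m by ring] at this

theorem IsPLCSpiral.shift {n k : ℕ} {P : ℤ → RP2} (h : IsPLCSpiral n k P) (m : ℤ) :
    IsPLCSpiral n k (fun q => P (q + m)) := by
  obtain ⟨u, h1, h2, h3, h4, h5⟩ := h
  refine ⟨fun j q => u j (q + m), fun q => h1 _, fun j hj q => ?_, fun q => ?_,
    fun j hj q => ?_, fun j hj j' hj' q q' hne => ?_⟩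
  · have := h2 j hj (q + m)
    rwa [show q + m - 1 = q - 1 + m by ring, show q + m + 1 = q + 1 + m by ring,
      show q + m + 2 = q + 2 + m by ring] at this
  · have := h3 (q + m)
    rwa [show q + m + n + k = q + n + k + m by ring] at this
  · have := h4 j hj (q + m)
    rwa [show q + m + 1 = q + 1 + m by ring, show q + m + 2 = q + 2 + m by ring] at this
  · have := h5 j hj j' hj' (q + m) (q' + m) (by simpa using hne)
    unfold halfOpenEdge at this ⊢
    rwa [show q + m + 1 = q + 1 + m by ring, show q' + m + 1 = q' + 1 + m by ring] at this

/-- The spiral relabeled so that its vertex `q + m` becomes the vertex `q`. -/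
def LabeledSpiral.shift {n k : ℕ} (m : ℤ) (P : LabeledSpiral n k) : LabeledSpiral n k :=
  ⟨fun q => P.1 (q + m), P.2.1.shift m, P.2.2.shift m⟩

/-- Relabeling by one unit, which moves the distinguished vertex one step inwards. -/
def spiralShift (n k : ℕ) : Equiv.Perm (LabeledSpiral n k) where
  toFun := LabeledSpiral.shift 1
  invFun := LabeledSpiral.shift (-1)
  left_inv P := Subtype.ext (funext fun q => congrArg P.1 (by ring))
  right_inv P := Subtype.ext (funext fun q => congrArg P.1 (by ring))

/-- The shift map `T_{n,k}` of `C(n, k)`, a bijection. -/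
def shiftMap (n k : ℕ) : Equiv.Perm (SpiralSpace n k) :=
  Quotient.congr (spiralShift n k) fun P Q => by
    constructor
    · rintro ⟨g, h⟩
      exact ⟨g, fun q => h (q + 1)⟩
    · rintro ⟨g, h⟩
      refine ⟨g, fun q => ?_⟩
      have := h (q - 1)
      simpa [spiralShift, LabeledSpiral.shift] using this

end

/-!
The vertices of the seeds that generate a spiral `P` can be lifted to `ℝ³` so that every seed
becomes a polygon all of whose volumes are positive (`IsSeed.exists_seedLift`). One step of the
seed map moves each vertex along the edge that starts there, and thus the signs agree along the
whole orbit. The last `k` vertices of the seeds trace out the paths `T(P), …, T^k(P)`, which are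
hence lifted as well (`IsGeneratedBySeed.exists_spiralLift`).

On the rays of these lifts there are vectors with a recurrence
`v (q + 2) = v (q + 1) - y q • v q + (x q * y q * y (q - 1)) • v (q - 1)`, and the positive numbers
`x q`, `y q` are projective invariants of the path. In these coordinates the pentagram map is
```
x' q = x q * (1 - x (q - 1) * y (q - 1)) / (1 - x (q + 1) * y (q + 1)),
y' q = y (q + 1) * (1 - x (q + 2) * y (q + 2)) / (1 - x q * y q),
```
where `0 < 1 - x q * y q < 1`. Both formulas are discrete conservation laws, whose densities are
`x` and `y` and whose fluxes are products of factors `1 - x q * y q` or of their inverses. Since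
`T^k` is a relabeling, each of them provides a product that does not depend on `q` (it is conserved
by the shift map): `k` fluxes times `n + k` factors `x`, and `k` fluxes times `n` factors `y`
(`conserved_prod`).

Since the seeds are convex and have `n ≥ 4` vertices, `x` is at most `1`. All factors of the first
product are therefore at most `1`, so each of them is bounded from below by the product; then the
second product bounds `y` from below. Consequently all coordinates along an orbit of the shift map
stay away from their degenerate values, uniformly (`NormalizedSpiral.exists_bound`).

A spiral with three vertices in standard position is determined by its coordinates, so that the
orbit lies in the image of a compact set of lifts (`isCompact_boundedSpirals`), defined by closed
conditions: the bounds, the recurrence, the periodicity and the weak convexity of the seeds. Every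
member of this set is in fact a spiral. The bounds make the corners of the seeds strictly
convex, and a weakly convex polygon with strictly convex corners is strictly convex
(`convex_of_nonneg_of_corner`). The edges of `P, T(P), …` are pairwise disjoint because they are
cut off, one after the other, from nested convex polygons (`SpiralLift.isPLCSpiral`), and the
polygons are seeds that follow one another under the seed map (`SpiralLift.isGeneratedBySeed`).

Thus the orbit is contained in a compact set. The coordinates are continuous and separate the
points of the space of spirals, which is therefore Hausdorff (`t2Space_spiralSpace`), and the
closure of the orbit is compact.
-/

open scoped Topology
open Set Filter

noncomputable section

/-! ### Volumes, positive multiples and cones in `ℝ³` -/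

/-- The signed volume of the parallelepiped spanned by three vectors. -/
def vol (u v w : Fin 3 → ℝ) : ℝ := Matrix.det ![u, v, w]

theorem vol_eq (u v w : Fin 3 → ℝ) :
    vol u v w = u 0 * v 1 * w 2 - u 0 * v 2 * w 1 - u 1 * v 0 * w 2 + u 1 * v 2 * w 0
      + u 2 * v 0 * w 1 - u 2 * v 1 * w 0 := by
  exact (Matrix.det_fin_three _).trans (by simp)

theorem continuous_vol {X : Type*} [TopologicalSpace X] {u v w : X → Fin 3 → ℝ}
    (hu : Continuous u) (hv : Continuous v) (hw : Continuous w) :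
    Continuous fun x => vol (u x) (v x) (w x) := by
  simp only [vol_eq]
  fun_prop

theorem vol_add_left (u u' v w : Fin 3 → ℝ) : vol (u + u') v w = vol u v w + vol u' v w := by
  simp only [vol_eq, Pi.add_apply]; ring

theorem vol_add_mid (u v v' w : Fin 3 → ℝ) : vol u (v + v') w = vol u v w + vol u v' w := by
  simp only [vol_eq, Pi.add_apply]; ring

theorem vol_add_right (u v w w' : Fin 3 → ℝ) : vol u v (w + w') = vol u v w + vol u v w' := by
  simp only [vol_eq, Pi.add_apply]; ring

theorem vol_smul_left (c : ℝ) (u v w : Fin 3 → ℝ) : vol (c • u) v w = c * vol u v w := by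
  simp only [vol_eq, Pi.smul_apply, smul_eq_mul]; ring

theorem vol_smul_mid (c : ℝ) (u v w : Fin 3 → ℝ) : vol u (c • v) w = c * vol u v w := by
  simp only [vol_eq, Pi.smul_apply, smul_eq_mul]; ring

theorem vol_smul_right (c : ℝ) (u v w : Fin 3 → ℝ) : vol u v (c • w) = c * vol u v w := by
  simp only [vol_eq, Pi.smul_apply, smul_eq_mul]; ring

theorem vol_self_left (u w : Fin 3 → ℝ) : vol u u w = 0 := by
  simp only [vol_eq]; ring

theorem vol_self_right (u w : Fin 3 → ℝ) : vol u w w = 0 := by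
  simp only [vol_eq]; ring

theorem vol_self_outer (u w : Fin 3 → ℝ) : vol u w u = 0 := by
  simp only [vol_eq]; ring

theorem vol_zero_left (u v : Fin 3 → ℝ) : vol 0 u v = 0 := by simp [vol_eq]

theorem vol_rotate (u v w : Fin 3 → ℝ) : vol u v w = vol v w u := by
  simp only [vol_eq]; ring

theorem vol_swap_left (u v w : Fin 3 → ℝ) : vol u v w = -vol v u w := by
  simp only [vol_eq]; ring

theorem vol_swap_right (u v w : Fin 3 → ℝ) : vol u v w = -vol u w v := by
  simp only [vol_eq]; ring

/-- Cramer's rule. -/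
theorem vol_smul_eq (p r m x : Fin 3 → ℝ) :
    vol p r m • x = vol x r m • p + vol p x m • r + vol p r x • m := by
  ext i
  fin_cases i <;> simp [vol_eq] <;> ring

/-- The Plücker relation between the volumes that contain a fixed vector `a`. -/
theorem vol_plucker (a p q r s : Fin 3 → ℝ) :
    vol a p r * vol a q s = vol a p q * vol a r s + vol a p s * vol a q r := by
  simp only [vol_eq]; ring

theorem vol_map (f : (Fin 3 → ℝ) →ₗ[ℝ] Fin 3 → ℝ) (u v w : Fin 3 → ℝ) :
    vol (f u) (f v) (f w) = LinearMap.det f * vol u v w := by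
  have h : (Matrix.of ![f u, f v, f w])
      = Matrix.of ![u, v, w] * (LinearMap.toMatrix' f).transpose := by
    ext i j
    rw [Matrix.mul_apply]
    have key : ∀ x : Fin 3 → ℝ, f x j = ∑ l, x l * (LinearMap.toMatrix' f).transpose l j := by
      intro x
      conv_lhs => rw [← LinearMap.toMatrix'_mulVec f x]
      simp [Matrix.mulVec, dotProduct, mul_comm]
    fin_cases i
    · exact key u
    · exact key v
    · exact key w
  have h' := congrArg Matrix.det h
  rw [Matrix.det_mul, Matrix.det_transpose, LinearMap.det_toMatrix', mul_comm] at h'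
  exact h'

/-- Three vectors of nonzero volume are carried to any other three by a linear isomorphism if
these have nonzero volume too. -/
theorem exists_linearEquiv_of_vol_ne_zero {p r m p' r' m' : Fin 3 → ℝ} (h : vol p r m ≠ 0)
    (h' : vol p' r' m' ≠ 0) :
    ∃ g : (Fin 3 → ℝ) ≃ₗ[ℝ] (Fin 3 → ℝ), g p = p' ∧ g r = r' ∧ g m = m' := by
  have key : ∀ u v w : Fin 3 → ℝ, vol u v w ≠ 0 →
      ∃ b : Module.Basis (Fin 3) ℝ (Fin 3 → ℝ), b 0 = u ∧ b 1 = v ∧ b 2 = w := by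
    intro u v w hne
    have hli : LinearIndependent ℝ ![u, v, w] :=
      Matrix.linearIndependent_rows_of_det_ne_zero (A := ![u, v, w]) hne
    refine ⟨basisOfLinearIndependentOfCardEqFinrank hli (by simp), ?_, ?_, ?_⟩ <;>
      simp
  obtain ⟨b, h0, h1, h2⟩ := key _ _ _ h
  obtain ⟨b', h0', h1', h2'⟩ := key _ _ _ h'
  refine ⟨b.equiv b' (Equiv.refl _), ?_, ?_, ?_⟩
  · rw [← h0, Module.Basis.equiv_apply, ← h0']; rfl
  · rw [← h1, Module.Basis.equiv_apply, ← h1']; rfl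
  · rw [← h2, Module.Basis.equiv_apply, ← h2']; rfl

theorem ne_zero_of_vol_ne_zero {u v w : Fin 3 → ℝ} (h : vol u v w ≠ 0) :
    u ≠ 0 ∧ v ≠ 0 ∧ w ≠ 0 := by
  refine ⟨?_, ?_, ?_⟩ <;> rintro rfl <;> simp [vol_eq] at h

/-- `x` is a positive multiple of `y`, so that the two are lifts of the same point, on the same
side of the origin. -/
def PosMul (x y : Fin 3 → ℝ) : Prop := ∃ c : ℝ, 0 < c ∧ x = c • y

theorem PosMul.refl (x : Fin 3 → ℝ) : PosMul x x := ⟨1, one_pos, (one_smul _ _).symm⟩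

theorem PosMul.symm {x y : Fin 3 → ℝ} : PosMul x y → PosMul y x := by
  rintro ⟨c, hc, rfl⟩
  exact ⟨c⁻¹, inv_pos.2 hc, by rw [smul_smul, inv_mul_cancel₀ hc.ne', one_smul]⟩

theorem PosMul.trans {x y z : Fin 3 → ℝ} : PosMul x y → PosMul y z → PosMul x z := by
  rintro ⟨c, hc, rfl⟩ ⟨d, hd, rfl⟩
  exact ⟨c * d, mul_pos hc hd, smul_smul _ _ _⟩

theorem PosMul.vol_pos {u v w u' v' w' : Fin 3 → ℝ} (hu : PosMul u u') (hv : PosMul v v')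
    (hw : PosMul w w') (h : 0 < vol u' v' w') : 0 < vol u v w := by
  obtain ⟨a, ha, rfl⟩ := hu
  obtain ⟨b, hb, rfl⟩ := hv
  obtain ⟨c, hc, rfl⟩ := hw
  rw [vol_smul_left, vol_smul_mid, vol_smul_right]
  positivity

theorem PosMul.inOpenCone {u w x u' w' x' : Fin 3 → ℝ} (hu : PosMul u u') (hw : PosMul w w')
    (hx : PosMul x x') (h : InOpenCone u' w' x') : InOpenCone u w x := by
  obtain ⟨a, ha, rfl⟩ := hu.symm
  obtain ⟨b, hb, rfl⟩ := hw.symm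
  obtain ⟨c, hc, rfl⟩ := hx
  obtain ⟨s, t, hs, ht, rfl⟩ := h
  exact ⟨c * (s * a), c * (t * b), by positivity, by positivity, by
    simp only [smul_add, smul_smul]⟩

theorem InOpenCone.trans_left {u w x y : Fin 3 → ℝ} (h : InOpenCone x w y)
    (hx : InOpenCone u w x) : InOpenCone u w y := by
  obtain ⟨s, t, hs, ht, rfl⟩ := hx
  obtain ⟨s', t', hs', ht', rfl⟩ := h
  exact ⟨s' * s, s' * t + t', by positivity, by positivity, by module⟩

theorem PosMul.mk_eq {x y : Fin 3 → ℝ} (h : PosMul x y) (hx : x ≠ 0) (hy : y ≠ 0) :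
    (Projectivization.mk ℝ x hx : RP2) = Projectivization.mk ℝ y hy := by
  obtain ⟨c, -, rfl⟩ := h
  exact (Projectivization.mk_eq_mk_iff' ℝ _ _ _ _).2 ⟨c, rfl⟩

/-- The intersection point of two distinct lines is the point at which the two linear forms that
cut out the lines vanish. -/
theorem mk_eq_meet_iff {a b c d x : Fin 3 → ℝ} (ha : a ≠ 0) (hb : b ≠ 0) (hc : c ≠ 0)
    (hd : d ≠ 0) (hx : x ≠ 0) (h : vol a b d ≠ 0) (h' : vol c d a ≠ 0) :
    (Projectivization.mk ℝ x hx : RP2) = meet (Projectivization.mk ℝ a ha)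
      (Projectivization.mk ℝ b hb) (Projectivization.mk ℝ c hc) (Projectivization.mk ℝ d hd) ↔
    vol a b x = 0 ∧ vol c d x = 0 := by
  have hv : ∀ u v w : Fin 3 → ℝ, vol u v w = w ⬝ᵥ crossProduct u v := fun u v w => by
    rw [triple_product_eq_det, ← vol, ← vol_rotate]
  have h1 : crossProduct a b ≠ 0 := fun h0 => h (by rw [hv, h0, dotProduct_zero])
  have h2 : crossProduct c d ≠ 0 := fun h0 => h' (by rw [hv, h0, dotProduct_zero])
  have hcr : crossProduct (crossProduct a b) (crossProduct c d)
      = vol a b d • c - vol a b c • d := by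
    ext i; fin_cases i <;> simp [vol_eq, cross_apply] <;> ring
  have h3 : crossProduct (crossProduct a b) (crossProduct c d) ≠ 0 := by
    rw [hcr]
    intro h0
    have : vol (vol a b d • c - vol a b c • d) d a = vol a b d * vol c d a := by
      simp only [vol_eq, Pi.sub_apply, Pi.smul_apply, smul_eq_mul]; ring
    rw [h0, vol_zero_left] at this
    exact mul_ne_zero h h' this.symm
  rw [meet, Projectivization.cross_mk_of_cross_ne_zero _ _ h1,
    Projectivization.cross_mk_of_cross_ne_zero _ _ h2,
    Projectivization.cross_mk_of_cross_ne_zero _ _ h3, Projectivization.mk_eq_mk_iff']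
  constructor
  · rintro ⟨e, rfl⟩
    rw [hcr]
    constructor <;> simp only [vol_eq, Pi.sub_apply, Pi.smul_apply, smul_eq_mul] <;> ring
  · rintro ⟨h4, h5⟩
    -- In the basis `c, d, a` the vector `x` has no component along `a`, and then `vol a b x = 0`
    -- fixes the ratio of the other two.
    have h6 := vol_smul_eq c d a x
    rw [h5, zero_smul, add_zero] at h6
    have h7 : vol x d a * vol a b c + vol c x a * vol a b d = 0 := by
      have := congrArg (vol a b) h6
      rw [vol_smul_right, h4, mul_zero, vol_add_right, vol_smul_right, vol_smul_right] at this
      exact this.symm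
    refine ⟨vol x d a / (vol a b d * vol c d a), ?_⟩
    have h8 : vol c x a = - (vol x d a * vol a b c) / vol a b d := by
      rw [eq_div_iff h]; linarith
    have h9 : x = (vol c d a)⁻¹ • (vol x d a • c + vol c x a • d) := by
      rw [← h6, smul_smul, inv_mul_cancel₀ h', one_smul]
    rw [hcr]
    refine Eq.trans ?_ h9.symm
    rw [h8]
    ext i
    simp only [Pi.sub_apply, Pi.add_apply, Pi.smul_apply, smul_eq_mul]
    field_simp
    ring

/-! ### Lifts of a spiral and its iterated pentagram images -/

/-- Volume conditions on the increasing triples of `1, …, n` carry over to all triples in cyclic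
order, for an `n`-periodic sequence of vectors. -/
theorem vol_cyclic {n : ℕ} {a : ℤ → Fin 3 → ℝ} (ha : Function.Periodic a n) {R : ℝ → Prop}
    (h : ∀ i j l : ℤ, 1 ≤ i → i < j → j < l → l ≤ n → R (vol (a i) (a j) (a l)))
    {i j l : ℤ} (hij : i < j) (hjl : j < l) (hli : l < i + n) : R (vol (a i) (a j) (a l)) := by
  have hn : (0 : ℤ) < n := by lia
  have hp : ∀ x : ℤ, a x = a (x - (i - 1) / n * n) := fun x =>
    ((ha.int_mul ((i - 1) / n)).sub_eq x).symm
  have h1 := Int.emod_add_mul_ediv (i - 1) n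
  have h2 := Int.emod_nonneg (i - 1) hn.ne'
  have h3 := Int.emod_lt_of_pos (i - 1) hn
  rw [hp i, hp j, hp l]
  set m : ℤ := (i - 1) / n * n with hm
  rw [mul_comm] at h1
  rcases le_or_gt (l - m) n with h4 | h4
  · exact h _ _ _ (by lia) (by lia) (by lia) h4
  rw [← ha.sub_eq (l - m)]
  rcases le_or_gt (j - m) n with h5 | h5
  · rw [← vol_rotate]
    exact h _ _ _ (by lia) (by lia) (by lia) h5
  · rw [← ha.sub_eq (j - m), vol_rotate]
    exact h _ _ _ (by lia) (by lia) (by lia) (by lia)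

/-- The vertices of the seed at time `q` in terms of lifts `V j` of the paths `T^j(P)`: they are
`V 0 q, V 0 (q + 1), …, V 0 (q + n - k - 1)` at `1, …, n - k`, followed by the last vertices
`V j (q - 2 j)` of the partial turns of `T^k(P), …, T(P)` at `n + 1 - j`. The index is extended
to the integers with period `n`. -/
def polygon (n k : ℕ) (V : ℕ → ℤ → Fin 3 → ℝ) (q i : ℤ) : Fin 3 → ℝ :=
  if (i - 1) % n < n - k then V 0 (q + (i - 1) % n)
  else V (n - (i - 1) % n).toNat (q - 2 * (n - (i - 1) % n))

/-- Lifts `V j` of the paths `T^j(P)`, `j ≤ k`, of a path `P` with the periodicity of a spiral of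
type `(n, k)`. The condition `cut` says that the diagonals of `T^j(P)` contain the vertices of
`T^(j+1)(P)` in the right order. -/
structure PathLift (n k : ℕ) (V : ℕ → ℤ → Fin 3 → ℝ) : Prop where
  pent : ∀ j < k, IsPentagramImage (V j) (V (j + 1))
  cut : ∀ j < k, ∀ q, InOpenCone (V (j + 1) q) (V j (q + 2)) (V (j + 1) (q + 1))
  wrap : ∀ q, PosMul (V k q) (V 0 (q + n + k))

/-- Lifts of a spiral for which the seeds lift to convex polygons of positive orientation. -/
structure SpiralLift (n k : ℕ) (V : ℕ → ℤ → Fin 3 → ℝ) : Prop extends PathLift n k V where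
  convex : ∀ q i j l : ℤ, i < j → j < l → l < i + n →
    0 < vol (polygon n k V q i) (polygon n k V q j) (polygon n k V q l)

section polygon

variable {n k : ℕ} {V : ℕ → ℤ → Fin 3 → ℝ}

theorem polygon_periodic (q : ℤ) : Function.Periodic (polygon n k V q) n := by
  intro i
  have : (i + n - 1) % n = (i - 1) % (n : ℤ) := by
    rw [show i + n - 1 = i - 1 + n by ring, Int.add_emod_right]
  simp only [polygon, this]

theorem polygon_first {q r : ℤ} (h0 : 0 ≤ r) (h : r < n - k) :
    polygon n k V q (r + 1) = V 0 (q + r) := by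
  have : (r + 1 - 1) % (n : ℤ) = r := by
    rw [add_sub_cancel_right]; exact Int.emod_eq_of_lt h0 (by lia)
  simp only [polygon, this, if_pos h]

theorem polygon_last (hkn : k < n) {q : ℤ} {j : ℕ} (hj : j ≤ k) :
    polygon n k V q (n + 1 - j) = V j (q - 2 * j) := by
  rcases Nat.eq_zero_or_pos j with rfl | h0
  · have := polygon_first (n := n) (k := k) (V := V) (q := q) le_rfl (by lia)
    rw [← polygon_periodic, zero_add] at this
    simpa [add_comm] using this
  · have : ((n : ℤ) + 1 - j - 1) % (n : ℤ) = n - j := by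
      rw [show (n : ℤ) + 1 - j - 1 = n - j by ring]
      exact Int.emod_eq_of_lt (by lia) (by lia)
    simp only [polygon, this]
    rw [if_neg (by lia), show ((n : ℤ) - (n - j)).toNat = j by lia,
      show (n : ℤ) - (n - j) = j by ring]

theorem polygon_one (hkn : k < n) {q : ℤ} : polygon n k V q 1 = V 0 q := by
  simpa using polygon_first (n := n) (k := k) (V := V) (q := q) le_rfl (by lia)

/-- A property of the positions in a seed holds for all integers if it holds for the first `n - k`
positions and for the last `k` ones. -/
theorem polygon_cases (hkn : k < n) {p : ℤ → Prop} (hp : ∀ i, p (i + n) ↔ p i)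
    (h1 : ∀ r : ℤ, 0 ≤ r → r < n - k → p (r + 1))
    (h2 : ∀ j : ℕ, 1 ≤ j → j ≤ k → p (n + 1 - j)) (i : ℤ) : p i := by
  have hn : (0 : ℤ) < n := by lia
  have hp' : Function.Periodic p n := fun i => propext (hp i)
  have h3 := Int.emod_add_mul_ediv (i - 1) n
  have h4 := Int.emod_nonneg (i - 1) hn.ne'
  have h5 := Int.emod_lt_of_pos (i - 1) hn
  have h6 : p i = p ((i - 1) % n + 1) := by
    rw [show (i - 1) % n + 1 = i - (i - 1) / n * n by rw [mul_comm]; lia]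
    exact ((hp'.int_mul _).sub_eq i).symm
  rw [h6]
  by_cases h : (i - 1) % n < n - k
  · exact h1 _ h4 h
  · have := h2 (n - (i - 1) % n).toNat (by lia) (by lia)
    rwa [show (n : ℤ) + 1 - ((n - (i - 1) % n).toNat : ℤ) = (i - 1) % n + 1 by lia] at this

end polygon

namespace PathLift

variable {n k : ℕ} {V : ℕ → ℤ → Fin 3 → ℝ}

/-- Among the first `n - k` positions, one step of the seed map is a shift. -/
theorem polygon_shift (hV : PathLift n k V) (hkn : k < n) {q r : ℤ} (h0 : 0 ≤ r)
    (h : r < n - k) : PosMul (polygon n k V (q + 1) (r + 1)) (polygon n k V q (r + 1 + 1)) := by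
  rw [polygon_first h0 h]
  rcases eq_or_lt_of_le (show r + 1 ≤ n - k by lia) with h1 | h1
  · have h2 : polygon n k V q (r + 1 + 1) = V k (q - 2 * k) := by
      rw [← polygon_last (V := V) hkn le_rfl]; congr 1; lia
    rw [h2]
    have := (hV.wrap (q - 2 * k)).symm
    rwa [show q - 2 * (k : ℤ) + n + k = q + 1 + r by lia] at this
  · rw [polygon_first (by lia) h1, show q + 1 + r = q + (r + 1) by ring]
    exact PosMul.refl _

/-- At the last `k` positions, one step of the seed map moves each vertex into the edge that
starts there. -/
theorem polygon_cut (hV : PathLift n k V) (hkn : k < n) {q : ℤ} {j : ℕ} (h1 : 1 ≤ j)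
    (hj : j ≤ k) : InOpenCone (polygon n k V q (n + 1 - j)) (polygon n k V q (n + 1 - j + 1))
      (polygon n k V (q + 1) (n + 1 - j)) := by
  obtain ⟨m, rfl⟩ : ∃ m, j = m + 1 := ⟨j - 1, by lia⟩
  have h2 : (n : ℤ) + 1 - ((m + 1 : ℕ) : ℤ) + 1 = n + 1 - m := by push_cast; ring
  rw [h2, polygon_last hkn hj, polygon_last hkn hj, polygon_last hkn (by lia : m ≤ k)]
  have := hV.cut m (by lia) (q - 2 * ((m + 1 : ℕ) : ℤ))
  rwa [show q - 2 * ((m + 1 : ℕ) : ℤ) + 2 = q - 2 * m by push_cast; ring,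
    show q - 2 * ((m + 1 : ℕ) : ℤ) + 1 = q + 1 - 2 * ((m + 1 : ℕ) : ℤ) by ring] at this

theorem polygon_step (hV : PathLift n k V) (hkn : k < n) (q i : ℤ) :
    ∃ s t : ℝ, 0 ≤ s ∧ 0 < t ∧
      polygon n k V (q + 1) i = s • polygon n k V q i + t • polygon n k V q (i + 1) := by
  refine polygon_cases (k := k) (p := fun i => ∃ s t : ℝ, 0 ≤ s ∧ 0 < t ∧
      polygon n k V (q + 1) i = s • polygon n k V q i + t • polygon n k V q (i + 1))
    hkn (fun i => ?_) (fun r h0 h => ?_) (fun j h1 hj => ?_) i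
  · rw [polygon_periodic, polygon_periodic, show i + n + 1 = i + 1 + n by ring, polygon_periodic]
  · obtain ⟨c, hc, h⟩ := hV.polygon_shift hkn h0 h (q := q)
    exact ⟨0, c, le_rfl, hc, by rw [h, zero_smul, zero_add]⟩
  · obtain ⟨s, t, hs, ht, h⟩ := hV.polygon_cut hkn h1 hj (q := q)
    exact ⟨s, t, hs.le, ht, h⟩

end PathLift

/-! ### Lifting a bi-infinite orbit of the seed map -/

/-- Lifts of the vertices of one seed, with consistent signs. The vectors that occur here are
nonzero because of the condition `convex`. -/
structure SeedLift (n k : ℕ) (S : SeedPoints) (α : ℤ → Fin 3 → ℝ) : Prop where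
  periodic : Function.Periodic α n
  convex : ∀ i j l : ℤ, i < j → j < l → l < i + n → 0 < vol (α i) (α j) (α l)
  lift_A : ∀ i : ℕ, 1 ≤ i → i ≤ n → ∀ h : α i ≠ 0, S.A i = Projectivization.mk ℝ (α i) h
  lift_B : ∀ j : ℕ, n < j + k → j ≤ n → ∃ x, InOpenCone (α j) (α (j + 1)) x ∧
    ∀ h : x ≠ 0, S.B j = Projectivization.mk ℝ x h

theorem IsSeed.exists_seedLift {n k : ℕ} {S : SeedPoints} (hkn : k < n) (hS : IsSeed n k S) :
    ∃ α, SeedLift n k S α := by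
  obtain ⟨g, a, b, hA, hB, hconv, hseg⟩ := hS
  set f : (Fin 3 → ℝ) →ₗ[ℝ] Fin 3 → ℝ := g.symm.toLinearMap with hf
  have hdet : LinearMap.det f ≠ 0 := by
    rw [hf, ← LinearEquiv.coe_det]
    exact Units.ne_zero _
  -- The factor `det f` corrects the orientation.
  let w : ℝ × ℝ → Fin 3 → ℝ := fun p => LinearMap.det f • f ![p.1, p.2, 1]
  have hw : ∀ p q r, vol (w p) (w q) (w r) = LinearMap.det f ^ 4 * orient p q r := by
    intro p q r
    simp only [w, vol_smul_left, vol_smul_mid, vol_smul_right, vol_map]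
    simp only [vol_eq, orient]
    simp
    ring
  have hmk : ∀ (X : RP2) p, g • X = affinePt p → ∀ h : w p ≠ 0,
      X = Projectivization.mk ℝ (w p) h := by
    intro X p hX h
    rw [← inv_smul_smul g X, hX, affinePt, Projectivization.smul_mk, Projectivization.mk_eq_mk_iff']
    exact ⟨(LinearMap.det f)⁻¹, by
      simp only [w]; rw [smul_smul, inv_mul_cancel₀ hdet, one_smul]; rfl⟩
  have hcone : ∀ p q r, r ∈ openSegment ℝ p q → InOpenCone (w p) (w q) (w r) := by
    rintro p q r ⟨s, t, hs, ht, hst, rfl⟩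
    refine ⟨s, t, hs, ht, ?_⟩
    simp only [w]
    rw [smul_comm s, smul_comm t, ← smul_add, ← map_smul f s, ← map_smul f t, ← map_add]
    congr 2
    ext i
    fin_cases i <;> simp [hst]
  have hn : ∀ i : ℕ, 1 ≤ i → i ≤ n → ((((i : ℤ) - 1) % n + 1).toNat) = i := by
    intro i h1 h2
    rw [Int.emod_eq_of_lt (by lia) (by lia)]
    lia
  have hn' : ∀ i : ℕ, 1 ≤ i → i ≤ n → ((((i : ℤ) + 1 - 1) % n + 1).toNat) = i % n + 1 := by
    intro i h1 h2
    rw [add_sub_cancel_right]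
    norm_cast
  refine ⟨fun i => w (a ((i - 1) % n + 1).toNat), ?_, ?_, ?_, ?_⟩
  · intro i
    simp only
    rw [show i + n - 1 = i - 1 + n by ring, Int.add_emod_right]
  · intro i j l hij hjl hli
    refine vol_cyclic (a := fun i => w (a ((i - 1) % n + 1).toNat)) (R := fun x => 0 < x)
      ?_ ?_ hij hjl hli
    · intro i
      simp only
      rw [show i + n - 1 = i - 1 + n by ring, Int.add_emod_right]
    · intro i j l h1 hij hjl hl
      lift i to ℕ using by lia
      lift j to ℕ using by lia
      lift l to ℕ using by lia
      rw [hn i (by lia) (by lia), hn j (by lia) (by lia), hn l (by lia) (by lia), hw]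
      have := hconv i j l (by lia) (by lia) (by lia) (by lia)
      have : 0 < LinearMap.det f ^ 4 := by positivity
      positivity
  · intro i h1 h2
    rw [hn i h1 h2]
    exact hmk _ _ (hA i h1 h2)
  · intro j h1 h2
    have h0 : 1 ≤ j := by lia
    rw [hn j h0 h2, hn' j h0 h2]
    exact ⟨w (b j), hcone _ _ _ (hseg j h1 h2), hmk _ _ (hB j h1 h2)⟩

/-- The volumes of a convex polygon on weakly increasing triples of positions. -/
theorem vol_nonneg_of_convex {n : ℕ} {α : ℤ → Fin 3 → ℝ} (hp : Function.Periodic α n)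
    (hα : ∀ i j l : ℤ, i < j → j < l → l < i + n → 0 < vol (α i) (α j) (α l))
    {i j l : ℤ} (hij : i ≤ j) (hjl : j ≤ l) (hli : l ≤ i + n) :
    0 ≤ vol (α i) (α j) (α l) := by
  rcases eq_or_lt_of_le hij with rfl | hij
  · rw [vol_self_left]
  rcases eq_or_lt_of_le hjl with rfl | hjl
  · rw [vol_self_right]
  rcases eq_or_lt_of_le hli with rfl | hli
  · rw [hp, vol_self_outer]
  exact (hα _ _ _ hij hjl hli).le

/-- A convex polygon stays convex if every vertex moves along the edge that starts there, by a
positive amount and at most to the end of the edge. -/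
theorem convex_of_step {n : ℕ} {α γ : ℤ → Fin 3 → ℝ} (hp : Function.Periodic α n)
    (hα : ∀ i j l : ℤ, i < j → j < l → l < i + n → 0 < vol (α i) (α j) (α l))
    (h : ∀ i, ∃ s t : ℝ, 0 ≤ s ∧ 0 < t ∧ γ i = s • α i + t • α (i + 1))
    (i j l : ℤ) (hij : i < j) (hjl : j < l) (hli : l < i + n) :
    0 < vol (γ i) (γ j) (γ l) := by
  obtain ⟨s, t, hs, ht, h1⟩ := h i
  obtain ⟨s', t', hs', ht', h2⟩ := h j
  obtain ⟨s'', t'', hs'', ht'', h3⟩ := h l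
  have w : ∀ {i j l : ℤ}, i ≤ j → j ≤ l → l ≤ i + n → 0 ≤ vol (α i) (α j) (α l) :=
    vol_nonneg_of_convex hp hα
  have := hα (i + 1) (j + 1) (l + 1) (by lia) (by lia) (by lia)
  have p1 := w (i := i) (j := j) (l := l) (by lia) (by lia) (by lia)
  have p2 := w (i := i) (j := j) (l := l + 1) (by lia) (by lia) (by lia)
  have p3 := w (i := i) (j := j + 1) (l := l) (by lia) (by lia) (by lia)
  have p4 := w (i := i) (j := j + 1) (l := l + 1) (by lia) (by lia) (by lia)
  have p5 := w (i := i + 1) (j := j) (l := l) (by lia) (by lia) (by lia)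
  have p6 := w (i := i + 1) (j := j) (l := l + 1) (by lia) (by lia) (by lia)
  have p7 := w (i := i + 1) (j := j + 1) (l := l) (by lia) (by lia) (by lia)
  rw [h1, h2, h3]
  simp only [vol_add_left, vol_add_mid, vol_add_right, vol_smul_left, vol_smul_mid,
    vol_smul_right]
  positivity

/-- Two convex polygons with at least four vertices, whose vertices are proportional, have
vertices that are proportional with positive factors. -/
theorem pos_of_convex_smul {n : ℕ} (hn : 4 ≤ n) {α γ : ℤ → Fin 3 → ℝ} {c : ℤ → ℝ}
    (hα : ∀ i j l : ℤ, i < j → j < l → l < i + n → 0 < vol (α i) (α j) (α l))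
    (hγ : ∀ i j l : ℤ, i < j → j < l → l < i + n → 0 < vol (γ i) (γ j) (γ l))
    (h : ∀ i, α i = c i • γ i) (i : ℤ) : 0 < c i := by
  have key : ∀ i j l : ℤ, i < j → j < l → l < i + n → 0 < c i * (c j * c l) := by
    intro i j l hij hjl hli
    have h1 := hα i j l hij hjl hli
    have h2 := hγ i j l hij hjl hli
    rw [h, h, h, vol_smul_left, vol_smul_mid, vol_smul_right, ← mul_assoc, ← mul_assoc] at h1
    have := (mul_pos_iff_of_pos_right h2).1 h1
    rwa [mul_assoc] at this
  have k1 := key i (i + 1) (i + 2) (by lia) (by lia) (by lia)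
  have k2 := key i (i + 1) (i + 3) (by lia) (by lia) (by lia)
  have k3 := key i (i + 2) (i + 3) (by lia) (by lia) (by lia)
  have k4 := key (i + 1) (i + 2) (i + 3) (by lia) (by lia) (by lia)
  by_contra h0
  have h0 : c i ≤ 0 := not_lt.1 h0
  -- The factors at any two of `i + 1, i + 2, i + 3` would have a negative product.
  have n1 : c (i + 1) * c (i + 2) < 0 := by nlinarith
  have n2 : c (i + 1) * c (i + 3) < 0 := by nlinarith
  have n3 : c (i + 2) * c (i + 3) < 0 := by nlinarith
  nlinarith [mul_pos_of_neg_of_neg n1 n2, sq_nonneg (c (i + 1))]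

/-- How lifts of a seed and of its image under the seed map are related. -/
structure StepLift (n k : ℕ) (α α' : ℤ → Fin 3 → ℝ) : Prop where
  step : ∀ i, ∃ s t : ℝ, 0 ≤ s ∧ 0 < t ∧ α' i = s • α i + t • α (i + 1)
  shift : ∀ i : ℤ, 1 ≤ i → i ≤ n - k → PosMul (α' i) (α (i + 1))
  cut : ∀ i : ℤ, n - k < i → i ≤ n → InOpenCone (α i) (α (i + 1)) (α' i)

theorem SeedLift.ne_zero {n k : ℕ} {S : SeedPoints} {α : ℤ → Fin 3 → ℝ} (h : SeedLift n k S α)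
    (hn : 3 ≤ n) (i : ℤ) : α i ≠ 0 :=
  (ne_zero_of_vol_ne_zero (h.convex i (i + 1) (i + 2) (by lia) (by lia) (by lia)).ne').1

theorem SeedLift.stepLift {n k : ℕ} (hn : 4 ≤ n) (hk : 1 ≤ k) (hkn : k < n) {S S' : SeedPoints}
    {α α' : ℤ → Fin 3 → ℝ} (h : SeedLift n k S α) (h' : SeedLift n k S' α')
    (hS : IsSeedMap n k S S') : StepLift n k α α' := by
  -- Up to the factors `c i`, whose signs are not known beforehand, the vertices of `α'` are those
  -- dictated by the seed map.
  have key : ∀ i : ℤ, ∃ s t c : ℝ, 0 ≤ s ∧ 0 < t ∧ α' i = c • (s • α i + t • α (i + 1)) ∧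
      ((i - 1) % n < n - k → s = 0) ∧ (n - k ≤ (i - 1) % n → 0 < s) := by
    refine polygon_cases (k := k) (p := fun i : ℤ => ∃ s t c : ℝ, 0 ≤ s ∧ 0 < t ∧
      α' i = c • (s • α i + t • α (i + 1)) ∧
      ((i - 1) % n < n - k → s = 0) ∧ (n - k ≤ (i - 1) % n → 0 < s)) hkn ?_ ?_ ?_
    · intro i
      rw [h.periodic, h'.periodic, show i + n + 1 = i + 1 + n by ring, h.periodic,
        show i + n - 1 = i - 1 + n by ring, Int.add_emod_right]
    · intro r h0 h1
      have e1 : (r + 1 - 1) % (n : ℤ) = r := by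
        rw [add_sub_cancel_right]; exact Int.emod_eq_of_lt h0 (by lia)
      have h2 := hS.A_first (r + 1).toNat (by lia) (by lia)
      have h3 := h'.lift_A (r + 1).toNat (by lia) (by lia) (h'.ne_zero (by lia) _)
      have h4 := h.lift_A ((r + 1).toNat + 1) (by lia) (by lia) (h.ne_zero (by lia) _)
      rw [h3, h4, Projectivization.mk_eq_mk_iff'] at h2
      obtain ⟨c, hc⟩ := h2
      rw [show (((r + 1).toNat : ℕ) : ℤ) = r + 1 by lia,
        show (((r + 1).toNat + 1 : ℕ) : ℤ) = r + 1 + 1 by lia] at hc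
      exact ⟨0, 1, c, le_rfl, one_pos, by rw [← hc]; module, fun _ => rfl, fun h5 => by lia⟩
    · intro j h1 hj
      have e1 : ((n : ℤ) + 1 - j - 1) % (n : ℤ) = n - j := by
        rw [show (n : ℤ) + 1 - j - 1 = n - j by ring]
        exact Int.emod_eq_of_lt (by lia) (by lia)
      have h2 := hS.A_last (n + 1 - j) (by lia) (by lia)
      have h3 := h'.lift_A (n + 1 - j) (by lia) (by lia) (h'.ne_zero (by lia) _)
      obtain ⟨x, ⟨s, t, hs, ht, rfl⟩, h4⟩ := h.lift_B (n + 1 - j) (by lia) (by lia)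
      rw [show ((n + 1 - j : ℕ) : ℤ) = (n : ℤ) + 1 - j by lia] at h4 h3
      have hne : s • α ((n : ℤ) + 1 - j) + t • α ((n : ℤ) + 1 - j + 1) ≠ 0 := by
        intro h0
        have := congrArg (fun x => vol x (α (n + 1 - j + 1)) (α (n + 1 - j + 2))) h0
        simp only [vol_add_left, vol_smul_left, vol_self_left, vol_zero_left, mul_zero,
          add_zero] at this
        exact (mul_pos hs (h.convex _ _ _ (by lia) (by lia) (by lia))).ne' this
      rw [h3, h4 hne, Projectivization.mk_eq_mk_iff'] at h2
      obtain ⟨c, hc⟩ := h2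
      exact ⟨s, t, c, hs.le, ht, hc.symm, fun h5 => by lia, fun _ => hs⟩
  choose s t c hs ht hc hs0 hs1 using key
  have hcpos : ∀ i, 0 < c i := pos_of_convex_smul hn h'.convex
    (convex_of_step h.periodic h.convex (γ := fun i => s i • α i + t i • α (i + 1))
      fun i => ⟨s i, t i, hs i, ht i, rfl⟩) hc
  refine ⟨fun i => ⟨c i * s i, c i * t i, mul_nonneg (hcpos i).le (hs i),
    mul_pos (hcpos i) (ht i), by rw [hc]; module⟩, fun i h1 h2 => ?_, fun i h1 h2 => ?_⟩
  · have h3 := hs0 i (by rw [Int.emod_eq_of_lt (by lia) (by lia)]; lia)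
    exact ⟨c i * t i, mul_pos (hcpos i) (ht i), by rw [hc, h3]; module⟩
  · have h3 := hs1 i (by rw [Int.emod_eq_of_lt (by lia) (by lia)]; lia)
    exact ⟨c i * s i, c i * t i, mul_pos (hcpos i) h3, mul_pos (hcpos i) (ht i),
      by rw [hc]; module⟩

/-- Three volumes that are positive in two steps of the seed map, at a cut corner. -/
theorem vol_pos_of_two_steps {n : ℕ} (hn : 3 ≤ n) {α α' α'' : ℤ → Fin 3 → ℝ}
    (hα : ∀ i j l : ℤ, i < j → j < l → l < i + n → 0 < vol (α i) (α j) (α l))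
    (hα' : ∀ i j l : ℤ, i < j → j < l → l < i + n → 0 < vol (α' i) (α' j) (α' l))
    (h : ∀ i, ∃ s t : ℝ, 0 ≤ s ∧ 0 < t ∧ α' i = s • α i + t • α (i + 1))
    (h' : ∀ i, ∃ s t : ℝ, 0 ≤ s ∧ 0 < t ∧ α'' i = s • α' i + t • α' (i + 1))
    (j : ℤ) (hj : InOpenCone (α j) (α (j + 1)) (α' j)) :
    0 < vol (α (j + 1)) (α' (j + 1)) (α'' (j + 1)) ∧
    0 < vol (α (j + 1)) (α' (j + 1)) (α' j) ∧
    0 < vol (α' j) (α' (j + 1)) (α'' (j + 1)) := by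
  obtain ⟨s, t, hs, ht, h1⟩ := h (j + 1)
  obtain ⟨s', t', hs', ht', h2⟩ := h' (j + 1)
  obtain ⟨s'', t'', hs'', ht'', h3⟩ := h (j + 1 + 1)
  obtain ⟨a, b, ha, hb, h4⟩ := hj
  have v1 := hα (j + 1) (j + 1 + 1) (j + 1 + 1 + 1) (by lia) (by lia) (by lia)
  have v2 := hα j (j + 1) (j + 1 + 1) (by lia) (by lia) (by lia)
  have v3 := hα' j (j + 1) (j + 1 + 1) (by lia) (by lia) (by lia)
  refine ⟨?_, ?_, ?_⟩
  · rw [h2, vol_add_right, vol_smul_right, vol_self_right, vol_smul_right, h3, h1]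
    simp only [vol_add_mid, vol_smul_mid, vol_self_left, vol_add_right, vol_smul_right,
      vol_self_right]
    simp only [mul_zero, zero_add]
    positivity
  · rw [h1, h4]
    simp only [vol_add_mid, vol_smul_mid, vol_self_left, vol_add_right, vol_smul_right,
      vol_self_outer]
    rw [vol_rotate] at v2
    simp only [mul_zero, zero_add, add_zero]
    positivity
  · rw [h2, vol_add_right, vol_smul_right, vol_self_right, vol_smul_right, mul_zero, zero_add]
    positivity

/-- The new points of the seed map are pentagram points. -/
theorem inOpenCone_of_vol_eq_zero {p r m z x : Fin 3 → ℝ} (h1 : 0 < vol p r m)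
    (h2 : 0 < vol p r z) (h3 : 0 < vol z r m) (hx : InOpenCone z r x) (h : vol p m x = 0) :
    InOpenCone p m x := by
  obtain ⟨s, t, hs, ht, rfl⟩ := hx
  have e := vol_smul_eq p r m (s • z + t • r)
  rw [vol_swap_right p (s • z + t • r) m, h, neg_zero, zero_smul, add_zero] at e
  simp only [vol_add_left, vol_smul_left, vol_self_left, vol_add_right, vol_smul_right,
    vol_self_right, mul_zero, add_zero] at e
  refine ⟨(vol p r m)⁻¹ * (s * vol z r m), (vol p r m)⁻¹ * (s * vol p r z), by positivity,
    by positivity, ?_⟩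
  rw [mul_smul _ (s * vol z r m), mul_smul _ (s * vol p r z), ← smul_add, ← e, smul_smul,
    inv_mul_cancel₀ h1.ne', one_smul]

/-- The lifts of the paths `T^j(P)` that are contained in lifts of the seeds. -/
def pathLift (n : ℕ) (α : ℤ → ℤ → Fin 3 → ℝ) (j : ℕ) (q : ℤ) : Fin 3 → ℝ :=
  α (q + 2 * j) (n + 1 - j)

theorem IsGeneratedBySeed.exists_spiralLift {n k : ℕ} (hn : 4 ≤ n) (hk : 1 ≤ k) (hkn : k < n)
    {P : ℤ → RP2} (hP : IsGeneratedBySeed n k P) :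
    ∃ V, SpiralLift n k V ∧ ∀ q (h : V 0 q ≠ 0), P q = Projectivization.mk ℝ (V 0 q) h := by
  obtain ⟨S, hS, hmap, hP⟩ := hP
  choose α hα using fun q => (hS q).exists_seedLift hkn
  have hst : ∀ q, StepLift n k (α q) (α (q + 1)) := fun q =>
    (hα q).stepLift hn hk hkn (hα (q + 1)) (hmap q)
  have hst' : ∀ q, StepLift n k (α (q + 1)) (α (q + 2)) := fun q => by
    have := hst (q + 1); rwa [show q + 1 + 1 = q + 2 by ring] at this
  have hne : ∀ q i, α q i ≠ 0 := fun q i => (hα q).ne_zero (by lia) i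
  have hA : ∀ q (i : ℕ), 1 ≤ i → i ≤ n → (S q).A i = Projectivization.mk ℝ (α q i) (hne q i) :=
    fun q i h1 h2 => (hα q).lift_A i h1 h2 _
  have hone : ∀ q, α q (n + 1) = α q 1 := fun q => by
    rw [add_comm, (hα q).periodic]
  have hdiag : ∀ q (j : ℤ), n - k < j → j ≤ n →
      InOpenCone (α q (j + 1)) (α (q + 2) (j + 1)) (α (q + 2) j) := by
    intro q j h1 h2
    obtain ⟨v1, v2, v3⟩ := vol_pos_of_two_steps (by lia) (hα q).convex (hα (q + 1)).convex
      (hst q).step (hst' q).step j ((hst q).cut j h1 h2)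
    refine inOpenCone_of_vol_eq_zero v1 v2 v3 ((hst' q).cut j h1 h2) ?_
    refine ((mk_eq_meet_iff (hne q (j + 1)) (hne (q + 2) (j + 1)) (hne (q + 1) j)
      (hne (q + 1) (j + 1)) (hne (q + 2) j) ?_ ?_).1 ?_).1
    · rw [vol_swap_right]; exact (neg_neg_of_pos v1).ne
    · rw [vol_rotate, vol_swap_left]; exact (neg_neg_of_pos v2).ne
    · lift j to ℕ using by lia
      have hB := (hmap (q + 1)).A_last j (by lia) (by lia)
      rw [show q + 1 + 1 = q + 2 by ring, hA _ j (by lia) (by lia)] at hB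
      rcases eq_or_lt_of_le (show j ≤ n by lia) with rfl | h3
      · have h4 := (hmap q).B_top
        have h5 := (hmap (q + 1)).A_first 1 le_rfl (by lia)
        rw [show q + 1 + 1 = q + 2 by ring] at h5
        rw [← hB, ← h5, hA _ 1 le_rfl (by lia), hA _ 1 le_rfl (by lia),
          hA _ 1 le_rfl (by lia), hA _ j (by lia) le_rfl] at h4
        simp only [hone]
        exact h4
      · have h4 := (hmap q).B_next j (by lia) h3
        have h5 := (hmap (q + 1)).A_last (j + 1) (by lia) (by lia)
        rw [show q + 1 + 1 = q + 2 by ring] at h5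
        rw [← hB, ← h5, hA _ (j + 1) (by lia) (by lia), hA _ (j + 1) (by lia) (by lia),
          hA _ (j + 1) (by lia) (by lia), hA _ j (by lia) (by lia)] at h4
        exact h4
  have hwrap : ∀ r : ℕ, r ≤ n - k → ∀ q, PosMul (α (q + r) 1) (α q (r + 1)) := by
    intro r
    induction r with
    | zero => intro _ q; simpa using PosMul.refl _
    | succ r ih =>
      intro h q
      have h1 := ih (by lia) (q + 1)
      have h2 := (hst q).shift (r + 1) (by lia) (by lia)
      push_cast
      rw [show q + (r + 1 : ℤ) = q + 1 + r by ring]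
      exact h1.trans h2
  have h0 : ∀ q, pathLift n α 0 q = α q 1 := fun q => by simp [pathLift, hone]
  refine ⟨pathLift n α, ⟨⟨?_, ?_, ?_⟩, ?_⟩, ?_⟩
  · intro j hj q
    have e : (n : ℤ) + 1 - (j + 1 : ℕ) + 1 = n + 1 - j := by push_cast; ring
    have d1 := hdiag (q + 2 * j) (n + 1 - (j + 1 : ℕ)) (by lia) (by lia)
    have d2 := hdiag (q + 2 * j - 1) (n + 1 - (j + 1 : ℕ)) (by lia) (by lia)
    have d3 := (hst' (q + 2 * j)).cut (n + 1 - (j + 1 : ℕ)) (by lia) (by lia)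
    rw [e] at d1 d2 d3
    simp only [pathLift]
    rw [show q - 1 + 2 * (j : ℤ) = q + 2 * j - 1 by ring,
      show q + 1 + 2 * (j : ℤ) = q + 2 * j + 1 by ring,
      show q + 2 + 2 * (j : ℤ) = q + 2 * j + 2 by ring,
      show q + 2 * ((j + 1 : ℕ) : ℤ) = q + 2 * j + 2 by push_cast; ring]
    rw [show q + 2 * (j : ℤ) - 1 + 2 = q + 2 * j + 1 by ring] at d2
    exact ⟨d3.trans_left d2, d1⟩
  · intro j hj q
    have d3 := (hst (q + 2 * (j + 1 : ℕ))).cut (n + 1 - (j + 1 : ℕ)) (by lia) (by lia)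
    simp only [pathLift]
    rw [show (n : ℤ) + 1 - (j + 1 : ℕ) + 1 = n + 1 - j by push_cast; ring] at d3
    rw [show q + 2 + 2 * (j : ℤ) = q + 2 * (j + 1 : ℕ) by push_cast; ring,
      show q + 1 + 2 * ((j + 1 : ℕ) : ℤ) = q + 2 * (j + 1 : ℕ) + 1 by ring]
    exact d3
  · intro q
    have h1 := hwrap (n - k) le_rfl (q + 2 * k)
    rw [h0, pathLift]
    rw [show q + 2 * (k : ℤ) + (n - k : ℕ) = q + n + k by lia,
      show ((n - k : ℕ) : ℤ) + 1 = n + 1 - k by lia] at h1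
    exact h1.symm
  · have hpoly : ∀ q i, PosMul (polygon n k (pathLift n α) q i) (α q i) := by
      intro q i
      refine polygon_cases (k := k)
        (p := fun i => PosMul (polygon n k (pathLift n α) q i) (α q i)) hkn ?_ ?_ ?_ i
      · intro i; rw [polygon_periodic, (hα q).periodic]
      · intro r h1 h2
        rw [polygon_first h1 h2, h0]
        lift r to ℕ using h1
        exact hwrap r (by lia) q
      · intro j h1 h2
        rw [polygon_last hkn h2, pathLift, sub_add_cancel]
        exact PosMul.refl _
    intro q i j l hij hjl hli
    exact (hpoly q i).vol_pos (hpoly q j) (hpoly q l) ((hα q).convex i j l hij hjl hli)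
  · intro q h
    rw [hP, hA q 1 le_rfl (by lia)]
    congr 1
    rw [h0]; rfl

/-! ### Normalized lifts and their coordinates -/

/-- The vectors `v q` satisfy a recurrence in which the coefficient of `v (q + 1)` is `1`. A
locally convex path whose pentagram image is defined has such lifts on the rays of any given
lifts, unique up to a common positive factor. The remaining coefficients are then projective
invariants; they are written in terms of `x` and `y` because the pentagram map has a simple form
in these coordinates. -/
structure Normalized (v : ℤ → Fin 3 → ℝ) (x y : ℤ → ℝ) : Prop where
  x_pos : ∀ q, 0 < x q
  y_pos : ∀ q, 0 < y q
  eq : ∀ q, v (q + 2) = v (q + 1) - y q • v q + (x q * y q * y (q - 1)) • v (q - 1)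

/-- The lift of the pentagram image of a normalized path that is again normalized. -/
def nextV (v : ℤ → Fin 3 → ℝ) (y : ℤ → ℝ) (q : ℤ) : Fin 3 → ℝ := v (q + 2) + y q • v q

/-- The coordinates `x` of the pentagram image. -/
def nextX (x y : ℤ → ℝ) (q : ℤ) : ℝ :=
  x q * (1 - x (q - 1) * y (q - 1)) / (1 - x (q + 1) * y (q + 1))

/-- The coordinates `y` of the pentagram image. -/
def nextY (x y : ℤ → ℝ) (q : ℤ) : ℝ :=
  y (q + 1) * (1 - x (q + 2) * y (q + 2)) / (1 - x q * y q)

theorem Normalized.nextV_eq {v : ℤ → Fin 3 → ℝ} {x y : ℤ → ℝ} (h : Normalized v x y) (q : ℤ) :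
    nextV v y q = v (q + 1) + (x q * y q * y (q - 1)) • v (q - 1) := by
  rw [nextV, h.eq]; module

theorem Normalized.next {v : ℤ → Fin 3 → ℝ} {x y : ℤ → ℝ} (h : Normalized v x y)
    (hlt : ∀ q, x q * y q < 1) : Normalized (nextV v y) (nextX x y) (nextY x y) := by
  have hp : ∀ q, 0 < 1 - x q * y q := fun q => sub_pos.2 (hlt q)
  refine ⟨fun q => div_pos (mul_pos (h.x_pos _) (hp _)) (hp _),
    fun q => div_pos (mul_pos (h.y_pos _) (hp _)) (hp _), fun q => ?_⟩
  have e1 : nextX x y q * nextY x y (q - 1) = x q * y q := by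
    have := (hp (q - 1)).ne'
    have := (hp (q + 1)).ne'
    simp only [nextX, nextY, sub_add_cancel, show q - 1 + 2 = q + 1 by ring]
    field_simp
  have e2 : nextY x y q * (1 - x q * y q) = y (q + 1) * (1 - x (q + 2) * y (q + 2)) :=
    div_mul_cancel₀ _ (hp q).ne'
  have e3 : nextX x y q * nextY x y q * nextY x y (q - 1) = nextY x y q * (x q * y q) := by
    rw [← e1]; ring
  rw [e3, h.nextV_eq (q + 2), h.nextV_eq q]
  simp only [nextV]
  rw [show q + 2 + 1 = q + 1 + 2 by ring, show q + 2 - 1 = q + 1 by ring,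
    show q - 1 + 2 = q + 1 by ring]
  have e4 : x (q + 2) * y (q + 2) * y (q + 1)
      = y (q + 1) - nextY x y q * (1 - x q * y q) := by rw [e2]; ring
  rw [e4]
  module

theorem exists_pos_ratio {ρ : ℤ → ℝ} (hρ : ∀ q, 0 < ρ q) :
    ∃ l : ℤ → ℝ, (∀ q, 0 < l q) ∧ ∀ q, l (q + 1) = ρ q * l q := by
  refine ⟨fun q => (∏ i ∈ Finset.range q.toNat, ρ i) / ∏ i ∈ Finset.range (-q).toNat, ρ (-1 - i),
    fun q => div_pos (Finset.prod_pos fun i _ => hρ _) (Finset.prod_pos fun i _ => hρ _),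
    fun q => ?_⟩
  simp only
  rcases le_or_gt 0 q with h | h
  · rw [show (-q).toNat = 0 by lia, show (-(q + 1)).toNat = 0 by lia,
      show (q + 1).toNat = q.toNat + 1 by lia, Finset.prod_range_succ,
      show ((q.toNat : ℕ) : ℤ) = q by lia]
    ring
  · rw [show q.toNat = 0 by lia, show (q + 1).toNat = 0 by lia,
      show (-q).toNat = (-(q + 1)).toNat + 1 by lia, Finset.prod_range_succ,
      show (-1 - (((-(q + 1)).toNat : ℕ) : ℤ)) = q by lia]
    have := (hρ q).ne'
    have : ∏ i ∈ Finset.range (-(q + 1)).toNat, ρ (-1 - i) ≠ 0 :=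
      (Finset.prod_pos fun i _ => hρ _).ne'
    field_simp

theorem IsPentagramImage.exists_normalized {u w : ℤ → Fin 3 → ℝ} (h : IsPentagramImage u w) :
    ∃ v x y, Normalized v x y ∧ ∀ q, PosMul (v q) (u q) := by
  choose h1 h2 using h
  choose s t hs ht hst using h1
  choose s' t' hs' ht' hst' using h2
  obtain ⟨l, hl, hl'⟩ := exists_pos_ratio (ρ := fun q => t' (q - 1) / t (q - 1))
    (fun q => div_pos (ht' _) (ht _))
  have hrat : ∀ q, l (q + 2) * t q = t' q * l (q + 1) := by
    intro q
    have := hl' (q + 1)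
    rw [show q + 1 + 1 = q + 2 by ring, add_sub_cancel_right] at this
    rw [this]
    have := (ht q).ne'
    field_simp
  have hy : ∀ q, 0 < l (q + 2) * s' q / (t' q * l q) := fun q =>
    div_pos (mul_pos (hl _) (hs' _)) (mul_pos (ht' _) (hl _))
  refine ⟨fun q => l q • u q,
    fun q => l (q + 2) * s q / (t' q * l (q - 1)) /
      (l (q + 2) * s' q / (t' q * l q) *
        (l (q - 1 + 2) * s' (q - 1) / (t' (q - 1) * l (q - 1)))),
    fun q => l (q + 2) * s' q / (t' q * l q), ⟨fun q => ?_, hy, fun q => ?_⟩,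
    fun q => ⟨l q, hl q, rfl⟩⟩
  · exact div_pos (div_pos (mul_pos (hl _) (hs _)) (mul_pos (ht' _) (hl _)))
      (mul_pos (hy _) (hy _))
  · rw [mul_assoc, div_mul_cancel₀ _ (mul_pos (hy _) (hy _)).ne', smul_smul, smul_smul]
    have e : t' q • u (q + 2) = t q • u (q + 1) - s' q • u q + s q • u (q - 1) := by
      have := (hst q).symm.trans (hst' q)
      rw [eq_sub_of_add_eq' this.symm]; module
    have e2 : u (q + 2) = (t' q)⁻¹ • (t q • u (q + 1) - s' q • u q + s q • u (q - 1)) := by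
      rw [← e, smul_smul, inv_mul_cancel₀ (ht' q).ne', one_smul]
    rw [e2]
    have n1 := (ht' q).ne'
    have n2 := (hl q).ne'
    have n3 := (hl (q - 1)).ne'
    have c1 : l (q + 2) * (t' q)⁻¹ * t q = l (q + 1) := by
      rw [mul_right_comm, hrat]; field_simp
    rw [← c1]
    have c2 : l (q + 2) * s' q / (t' q * l q) * l q = l (q + 2) * (t' q)⁻¹ * s' q := by
      field_simp
    have c3 : l (q + 2) * s q / (t' q * l (q - 1)) * l (q - 1) = l (q + 2) * (t' q)⁻¹ * s q := by
      field_simp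
    rw [c2, c3]
    module

/-- Coefficients of a linear combination of three independent vectors are unique. -/
theorem coeff_unique {p r m : Fin 3 → ℝ} (h : vol p r m ≠ 0) {a b c a' b' c' : ℝ}
    (e : a • p + b • r + c • m = a' • p + b' • r + c' • m) : a = a' ∧ b = b' ∧ c = c' := by
  refine ⟨?_, ?_, ?_⟩
  · have := congrArg (fun x => vol x r m) e
    simpa [vol_add_left, vol_smul_left, vol_self_left, vol_self_right, vol_self_outer, h]
      using this
  · have := congrArg (fun x => vol p x m) e
    simpa [vol_add_mid, vol_smul_mid, vol_self_left, vol_self_right, vol_self_outer, h]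
      using this
  · have := congrArg (fun x => vol p r x) e
    simpa [vol_add_right, vol_smul_right, vol_self_left, vol_self_right, vol_self_outer, h]
      using this

/-- Two crossing segments determine the ray of their crossing point. -/
theorem posMul_of_inOpenCone {a b c d x x' : Fin 3 → ℝ} (h : vol a b c ≠ 0)
    (h1 : InOpenCone a c x) (h2 : InOpenCone b d x) (h1' : InOpenCone a c x')
    (h2' : InOpenCone b d x') : PosMul x' x := by
  obtain ⟨s, t, hs, ht, rfl⟩ := h1
  obtain ⟨s', t', hs', ht', rfl⟩ := h1'
  obtain ⟨p, q, hp, hq, e⟩ := h2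
  obtain ⟨p', q', hp', hq', e'⟩ := h2'
  have e3 : q' * s = q * s' ∧ q' * p = q * p' ∧ q' * t = q * t' := by
    have : (q' * s) • a + (-(q' * p)) • b + (q' * t) • c
        = (q * s') • a + (-(q * p')) • b + (q * t') • c := by
      have e4 : q' • (s • a + t • c) - (q' * p) • b = q • (s' • a + t' • c) - (q * p') • b := by
        rw [e, e']; module
      calc _ = q' • (s • a + t • c) - (q' * p) • b := by module
        _ = _ := e4
        _ = _ := by module
    have h3 := coeff_unique h this
    exact ⟨h3.1, neg_injective h3.2.1, h3.2.2⟩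
  refine ⟨q' / q, div_pos hq' hq, ?_⟩
  have s1 : s' = q' / q * s := by rw [div_mul_eq_mul_div, e3.1]; field_simp
  have t1 : t' = q' / q * t := by rw [div_mul_eq_mul_div, e3.2.2]; field_simp
  rw [s1, t1]; module

theorem SpiralLift.locallyConvex {n k : ℕ} {V : ℕ → ℤ → Fin 3 → ℝ} (hV : SpiralLift n k V)
    (hn : 3 ≤ n) (hkn : k < n) {j : ℕ} (hj : j ≤ k) (q : ℤ) :
    0 < vol (V j q) (V j (q + 1)) (V j (q + 2)) := by
  have key : ∀ q i, 0 < vol (polygon n k V q i) (polygon n k V (q + 1) i)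
      (polygon n k V (q + 1 + 1) i) := by
    intro q i
    obtain ⟨s, t, hs, ht, h1⟩ := hV.toPathLift.polygon_step hkn q i
    obtain ⟨s', t', hs', ht', h2⟩ := hV.toPathLift.polygon_step hkn (q + 1) i
    obtain ⟨s'', t'', hs'', ht'', h3⟩ := hV.toPathLift.polygon_step hkn q (i + 1)
    have v := hV.convex q i (i + 1) (i + 1 + 1) (by lia) (by lia) (by lia)
    rw [h2, h3, h1]
    simp only [vol_add_mid, vol_smul_mid, vol_add_right, vol_smul_right, vol_self_left,
      vol_self_right]
    simp only [mul_zero, zero_add, add_zero]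
    positivity
  have := key (q + 2 * j) (n + 1 - j)
  rw [polygon_last hkn hj, polygon_last hkn hj, polygon_last hkn hj] at this
  rwa [show q + 2 * (j : ℤ) - 2 * j = q by ring, show q + 2 * (j : ℤ) + 1 - 2 * j = q + 1 by ring,
    show q + 2 * (j : ℤ) + 1 + 1 - 2 * j = q + 2 by ring] at this

/-- Normalized lifts of a spiral of type `(n, k)` and of all its iterated pentagram images. The
lifts are periodic up to the factor `c`, and the coordinates are periodic. -/
structure NormalizedSpiral (n k : ℕ) (c : ℝ) (V : ℕ → ℤ → Fin 3 → ℝ) (x y : ℕ → ℤ → ℝ) :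
    Prop where
  normalized : ∀ j, Normalized (V j) (x j) (y j)
  lt_one : ∀ j q, x j q * y j q < 1
  succ_V : ∀ j, V (j + 1) = nextV (V j) (y j)
  succ_x : ∀ j, x (j + 1) = nextX (x j) (y j)
  succ_y : ∀ j, y (j + 1) = nextY (x j) (y j)
  c_pos : 0 < c
  wrap_V : ∀ q, V k q = c • V 0 (q + n + k)
  wrap_x : ∀ j q, x (j + k) q = x j (q + n + k)
  wrap_y : ∀ j q, y (j + k) q = y j (q + n + k)

/-- Normalized lifts of the same path agree up to a common factor. -/
theorem Normalized.unique {v w : ℤ → Fin 3 → ℝ} {x y x' y' : ℤ → ℝ} (h : Normalized v x y)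
    (h' : Normalized w x' y') (hvol : ∀ q, vol (w q) (w (q + 1)) (w (q + 2)) ≠ 0)
    (hvw : ∀ q, PosMul (v q) (w q)) : x = x' ∧ y = y' ∧ ∃ c : ℝ, 0 < c ∧ ∀ q, v q = c • w q := by
  choose c hc hcv using hvw
  have key : ∀ q, c (q + 2) = c (q + 1) ∧ y q * c q = c (q + 2) * y' q ∧
      x q * y q * y (q - 1) * c (q - 1) = c (q + 2) * (x' q * y' q * y' (q - 1)) := by
    intro q
    have e := h.eq q
    rw [hcv, hcv (q + 1), hcv q, hcv (q - 1), h'.eq] at e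
    have hv := hvol (q - 1)
    rw [sub_add_cancel, show q - 1 + 2 = q + 1 by ring] at hv
    have := coeff_unique hv (a := c (q + 2) * (x' q * y' q * y' (q - 1)))
      (b := -(c (q + 2) * y' q)) (c := c (q + 2)) (a' := x q * y q * y (q - 1) * c (q - 1))
      (b' := -(y q * c q)) (c' := c (q + 1)) (by
        calc _ = c (q + 2) • (w (q + 1) - y' q • w q + (x' q * y' q * y' (q - 1)) • w (q - 1)) := by
              module
          _ = _ := e
          _ = _ := by module)
    exact ⟨this.2.2, neg_injective this.2.1.symm, this.1.symm⟩
  have hconst : ∀ q, c q = c 0 := by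
    have hs : ∀ q, c (q + 1) = c q := fun q => by
      have := (key (q - 1)).1
      rwa [show q - 1 + 2 = q + 1 by ring, sub_add_cancel] at this
    intro q
    induction q using Int.induction_on with
    | zero => rfl
    | succ i ih => rw [hs, ih]
    | pred i ih => rw [← hs, sub_add_cancel, ih]
  have hy : y = y' := funext fun q => by
    have := (key q).2.1
    rw [hconst q, hconst (q + 2), mul_comm] at this
    exact mul_left_cancel₀ (hc 0).ne' this
  subst hy
  refine ⟨funext fun q => ?_, rfl, c 0, hc 0, fun q => by rw [hcv, hconst]⟩
  have := (key q).2.2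
  rw [hconst (q - 1), hconst (q + 2), mul_comm, mul_assoc, mul_assoc] at this
  exact mul_right_cancel₀ (mul_pos (h.y_pos q) (h.y_pos (q - 1))).ne'
    (mul_left_cancel₀ (hc 0).ne' this)

theorem Normalized.shift {v : ℤ → Fin 3 → ℝ} {x y : ℤ → ℝ} (h : Normalized v x y) (m : ℤ) :
    Normalized (fun q => v (q + m)) (fun q => x (q + m)) (fun q => y (q + m)) := by
  refine ⟨fun q => h.x_pos _, fun q => h.y_pos _, fun q => ?_⟩
  have := h.eq (q + m)
  rwa [show q + m + 2 = q + 2 + m by ring, show q + m + 1 = q + 1 + m by ring,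
    show q + m - 1 = q - 1 + m by ring] at this

/-- One step of the pentagram map from a normalized lift of `T^j(P)`. -/
theorem SpiralLift.normalized_step {n k : ℕ} {V : ℕ → ℤ → Fin 3 → ℝ} (hV : SpiralLift n k V)
    (hn : 3 ≤ n) (hkn : k < n) {j : ℕ} (hj : j < k) {v : ℤ → Fin 3 → ℝ} {x y : ℤ → ℝ}
    (h : Normalized v x y) (hv : ∀ q, PosMul (v q) (V j q)) :
    (∀ q, PosMul (nextV v y q) (V (j + 1) q)) ∧ ∀ q, x q * y q < 1 := by
  have hvol : ∀ q, 0 < vol (v q) (v (q + 1)) (v (q + 2)) := fun q =>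
    (hv _).vol_pos (hv _) (hv _) (hV.locallyConvex hn hkn hj.le q)
  have h1 : ∀ q, PosMul (nextV v y q) (V (j + 1) q) := by
    intro q
    have p := hV.pent j hj q
    have hvq := hvol (q - 1)
    rw [sub_add_cancel, show q - 1 + 2 = q + 1 by ring] at hvq
    refine posMul_of_inOpenCone (a := v (q - 1)) (b := v q) (c := v (q + 1)) (d := v (q + 2))
      hvq.ne' ((hv _).inOpenCone (hv _) (PosMul.refl _) p.1)
      ((hv _).inOpenCone (hv _) (PosMul.refl _) p.2) ?_ ?_
    · rw [h.nextV_eq]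
      exact ⟨x q * y q * y (q - 1), 1, mul_pos (mul_pos (h.x_pos _) (h.y_pos _)) (h.y_pos _),
        one_pos, by module⟩
    · exact ⟨y q, 1, h.y_pos _, one_pos, by rw [nextV]; module⟩
  refine ⟨h1, fun q => ?_⟩
  obtain ⟨s, t, hs, ht, e⟩ := (h1 _).inOpenCone (hv _) (h1 _) (hV.cut j hj (q - 1))
  rw [h.nextV_eq, sub_add_cancel, nextV, show q - 1 + 2 = q + 1 by ring] at e
  have hvq := hvol (q - 1)
  rw [sub_add_cancel, show q - 1 + 2 = q + 1 by ring] at hvq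
  have := coeff_unique hvq.ne' (a := x q * y q * y (q - 1)) (b := 0) (c := 1)
    (a' := s * y (q - 1)) (b' := 0) (c' := s + t) (by
      calc _ = v (q + 1) + (x q * y q * y (q - 1)) • v (q - 1) := by module
        _ = _ := e
        _ = _ := by module)
  have h2 := mul_right_cancel₀ (h.y_pos (q - 1)).ne' this.1
  linarith [this.2.2]

/-- The sequence of iterated pentagram images in coordinates. -/
def pentagramIter (v : ℤ → Fin 3 → ℝ) (x y : ℤ → ℝ) :
    ℕ → (ℤ → Fin 3 → ℝ) × (ℤ → ℝ) × (ℤ → ℝ)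
  | 0 => (v, x, y)
  | j + 1 =>
    (nextV (pentagramIter v x y j).1 (pentagramIter v x y j).2.2,
      nextX (pentagramIter v x y j).2.1 (pentagramIter v x y j).2.2,
      nextY (pentagramIter v x y j).2.1 (pentagramIter v x y j).2.2)

theorem SpiralLift.exists_normalizedSpiral {n k : ℕ} {V : ℕ → ℤ → Fin 3 → ℝ}
    (hV : SpiralLift n k V) (hn : 3 ≤ n) (hk : 1 ≤ k) (hkn : k < n) :
    ∃ c W x y, NormalizedSpiral n k c W x y ∧ ∀ j ≤ k, ∀ q, PosMul (W j q) (V j q) := by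
  obtain ⟨v, x, y, h0, hv0⟩ := (hV.pent 0 hk).exists_normalized
  let W : ℕ → ℤ → Fin 3 → ℝ := fun j => (pentagramIter v x y j).1
  let X : ℕ → ℤ → ℝ := fun j => (pentagramIter v x y j).2.1
  let Y : ℕ → ℤ → ℝ := fun j => (pentagramIter v x y j).2.2
  have sX : ∀ j, X (j + 1) = nextX (X j) (Y j) := fun j => rfl
  have sY : ∀ j, Y (j + 1) = nextY (X j) (Y j) := fun j => rfl
  have hW : ∀ j ≤ k, Normalized (W j) (X j) (Y j) ∧ ∀ q, PosMul (W j q) (V j q) := by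
    intro j
    induction j with
    | zero => exact fun _ => ⟨h0, hv0⟩
    | succ j ih =>
      intro hj
      obtain ⟨h1, h2⟩ := ih (by lia)
      obtain ⟨h3, h4⟩ := hV.normalized_step hn hkn hj h1 h2
      exact ⟨h1.next h4, h3⟩
  have hlt : ∀ j < k, ∀ q, X j q * Y j q < 1 := fun j hj =>
    (hV.normalized_step hn hkn hj (hW j hj.le).1 (hW j hj.le).2).2
  have hshift := (hW 0 (by lia)).1.shift (n + k)
  obtain ⟨wx, wy, c, hc, wV⟩ := (hW k le_rfl).1.unique hshift
    (fun q => by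
      have e := hV.locallyConvex hn hkn (Nat.zero_le k) (q + (n + k))
      rw [show q + ((n : ℤ) + k) + 1 = q + 1 + (n + k) by ring,
        show q + ((n : ℤ) + k) + 2 = q + 2 + (n + k) by ring] at e
      exact ((hv0 _).vol_pos (hv0 _) (hv0 _) e).ne')
    (fun q => ((hW k le_rfl).2 q).trans (((hV.wrap q).trans
      (by rw [add_assoc]; exact (hv0 _).symm))))
  have wXY : ∀ j, (∀ q, X (j + k) q = X j (q + n + k)) ∧ ∀ q, Y (j + k) q = Y j (q + n + k) := by
    intro j
    induction j with
    | zero =>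
      rw [zero_add]
      exact ⟨fun q => by rw [wx, add_assoc], fun q => by rw [wy, add_assoc]⟩
    | succ j ih =>
      obtain ⟨i1, i2⟩ := ih
      rw [show j + 1 + k = j + k + 1 by ring, sX, sY, sX, sY]
      refine ⟨fun q => ?_, fun q => ?_⟩
      · simp only [nextX, i1, i2]
        rw [show q - 1 + (n : ℤ) + k = q + n + k - 1 by ring,
          show q + 1 + (n : ℤ) + k = q + n + k + 1 by ring]
      · simp only [nextY, i1, i2]
        rw [show q + 1 + (n : ℤ) + k = q + n + k + 1 by ring,
          show q + 2 + (n : ℤ) + k = q + n + k + 2 by ring]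
  have hlt' : ∀ j q, X j q * Y j q < 1 := by
    intro j
    induction j using Nat.strong_induction_on with
    | _ j ih =>
      intro q
      rcases lt_or_ge j k with h | h
      · exact hlt j h q
      · obtain ⟨i, rfl⟩ : ∃ i, j = i + k := ⟨j - k, by lia⟩
        rw [(wXY i).1, (wXY i).2]
        exact ih i (by lia) _
  refine ⟨c, W, X, Y, ⟨fun j => ?_, hlt', fun j => rfl, sX, sY, hc,
    fun q => by rw [wV, add_assoc], fun j => (wXY j).1, fun j => (wXY j).2⟩,
    fun j hj => (hW j hj).2⟩
  induction j with
  | zero => exact h0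
  | succ j ih => exact ih.next (hlt' j)

/-! ### Conserved quantities and uniform bounds -/

/-- A discrete conservation law for a density `D` and a flux `F`, with a density that is
quasi-periodic in time, has a conserved total: the flux through a segment of `k` time steps and
the density along a segment of `N` points. -/
theorem conserved_prod {D F : ℕ → ℤ → ℝ} {k N : ℕ} (hD : ∀ j q, D j q ≠ 0)
    (h : ∀ j q, D (j + 1) q * F j (q + 1) = D j q * F j q) (hper : ∀ q, D k q = D 0 (q + N))
    (q : ℤ) : (∏ j ∈ Finset.range k, F j q) * ∏ i ∈ Finset.range N, D 0 (q + i)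
      = (∏ j ∈ Finset.range k, F j 0) * ∏ i ∈ Finset.range N, D 0 (0 + i) := by
  have h1 : ∀ q, ∀ k : ℕ, (∏ j ∈ Finset.range k, F j (q + 1)) * D k q
      = (∏ j ∈ Finset.range k, F j q) * D 0 q := by
    intro q k
    induction k with
    | zero => simp
    | succ k ih =>
      rw [Finset.prod_range_succ, Finset.prod_range_succ, mul_assoc, mul_comm (F k (q + 1)), h,
        mul_right_comm, ← ih]
      ring
  have h2 : ∀ q, (∏ i ∈ Finset.range N, D 0 (q + 1 + i)) * D 0 q
      = (∏ i ∈ Finset.range N, D 0 (q + i)) * D 0 (q + N) := by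
    intro q
    rw [← Finset.prod_range_succ (fun i : ℕ => D 0 (q + i)), Finset.prod_range_succ']
    congr 1
    · refine Finset.prod_congr rfl fun i _ => ?_
      congr 1; push_cast; ring
    · simp
  have h3 : ∀ q, (∏ j ∈ Finset.range k, F j (q + 1)) * ∏ i ∈ Finset.range N, D 0 (q + 1 + i)
      = (∏ j ∈ Finset.range k, F j q) * ∏ i ∈ Finset.range N, D 0 (q + i) := by
    intro q
    have e1 := h1 q k
    have e2 := h2 q
    rw [← hper] at e2
    refine mul_right_cancel₀ (mul_ne_zero (hD k q) (hD 0 q)) ?_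
    calc _ = ((∏ j ∈ Finset.range k, F j (q + 1)) * D k q)
          * ((∏ i ∈ Finset.range N, D 0 (q + 1 + i)) * D 0 q) := by ring
      _ = _ := by rw [e1, e2]; ring
  induction q using Int.induction_on with
  | zero => rfl
  | succ i ih => rw [h3, ih]
  | pred i ih => rw [← ih, ← h3, sub_add_cancel]

theorem prod_le_mul_pow {s : Finset ℕ} {f : ℕ → ℝ} {M : ℝ} (hM : 1 ≤ M)
    (hf : ∀ i ∈ s, 0 < f i ∧ f i ≤ M) {i : ℕ} (hi : i ∈ s) :
    ∏ i ∈ s, f i ≤ f i * M ^ s.card := by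
  rw [← Finset.mul_prod_erase s f hi]
  refine mul_le_mul_of_nonneg_left ?_ (hf i hi).1.le
  refine (Finset.prod_le_prod (fun j hj => (hf j (Finset.mem_of_mem_erase hj)).1.le)
    fun j hj => (hf j (Finset.mem_of_mem_erase hj)).2).trans ?_
  rw [Finset.prod_const]
  exact pow_le_pow_right₀ hM (Finset.card_erase_le)

/-- If the seeds have at least four vertices, then, seen from `P q`, the vertex `P (q + 4)` does not
precede `P (q + 3)`. In coordinates this says that `x` is at most `1`. -/
theorem SpiralLift.vol_three_four_nonneg {n k : ℕ} {V : ℕ → ℤ → Fin 3 → ℝ}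
    (hV : SpiralLift n k V) (hn : 4 ≤ n) (hkn : k < n) (q : ℤ) :
    0 ≤ vol (V 0 q) (V 0 (q + 3)) (V 0 (q + 4)) := by
  -- Seen from the first vertex of the polygon at time `q`, the vertices `1, …, n + 1 - t` of the
  -- polygon at time `q + t` are in (weakly) increasing order.
  have key : ∀ t : ℕ, ∀ i j : ℤ, 1 ≤ i → i < j → j + t ≤ n + 1 →
      0 ≤ vol (polygon n k V q 1) (polygon n k V (q + t) i) (polygon n k V (q + t) j) := by
    intro t
    induction t with
    | zero =>
      intro i j hi hij hj
      rw [Nat.cast_zero, add_zero]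
      exact vol_nonneg_of_convex (polygon_periodic q) (hV.convex q) hi hij.le (by lia)
    | succ t ih =>
      intro i j hi hij hj
      obtain ⟨s, r, hs, hr, h1⟩ := hV.toPathLift.polygon_step hkn (q + t) i
      obtain ⟨s', r', hs', hr', h2⟩ := hV.toPathLift.polygon_step hkn (q + t) j
      rw [show q + ((t + 1 : ℕ) : ℤ) = q + t + 1 by push_cast; ring, h1, h2]
      simp only [vol_add_mid, vol_smul_mid, vol_add_right, vol_smul_right]
      have p1 := ih i j hi hij (by lia)
      have p2 := ih i (j + 1) hi (by lia) (by lia)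
      have p4 := ih (i + 1) (j + 1) (by lia) (by lia) (by lia)
      have p3 : 0 ≤ vol (polygon n k V q 1) (polygon n k V (q + t) (i + 1))
          (polygon n k V (q + t) j) := by
        rcases eq_or_lt_of_le (show i + 1 ≤ j by lia) with h | h
        · rw [h, vol_self_right]
        · exact ih (i + 1) j (by lia) h (by lia)
      positivity
  have h1 := key 3 1 2 le_rfl (by lia) (by lia)
  obtain ⟨c, hc, h2⟩ := hV.toPathLift.polygon_shift hkn (q := q + 3) le_rfl (by lia)
  rw [zero_add, show q + 3 + 1 = q + 4 by ring, polygon_one hkn] at h2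
  rw [h2, vol_smul_right]
  rw [polygon_one hkn, Nat.cast_ofNat, polygon_one hkn] at h1
  exact mul_nonneg hc.le h1

theorem Normalized.x_le_one {v : ℤ → Fin 3 → ℝ} {x y : ℤ → ℝ} (h : Normalized v x y)
    (hv : ∀ q, 0 < vol (v q) (v (q + 1)) (v (q + 2)))
    (hv' : ∀ q, 0 ≤ vol (v q) (v (q + 3)) (v (q + 4))) (q : ℤ) : x q ≤ 1 := by
  have h1 := h.eq (q - 1)
  have h2 := h.eq q
  have h3 := hv (q - 2)
  have h4 := hv' (q - 2)
  rw [show q - 2 + 3 = q + 1 by ring, show q - 2 + 4 = q + 2 by ring, h2] at h4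
  rw [show q - 1 + 2 = q + 1 by ring, sub_add_cancel, show q - 1 - 1 = q - 2 by ring] at h1
  rw [show q - 2 + 1 = q - 1 by ring, show q - 2 + 2 = q by ring] at h3
  rw [h1] at h4
  have e : vol (v (q - 2))
      (v q - y (q - 1) • v (q - 1) + (x (q - 1) * y (q - 1) * y (q - 2)) • v (q - 2))
      (v q - y (q - 1) • v (q - 1) + (x (q - 1) * y (q - 1) * y (q - 2)) • v (q - 2)
        - y q • v q + (x q * y q * y (q - 1)) • v (q - 1))
      = (y q * y (q - 1) * (1 - x q)) * vol (v (q - 2)) (v (q - 1)) (v q) := by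
    simp only [vol_eq, Pi.add_apply, Pi.sub_apply, Pi.smul_apply, smul_eq_mul]
    ring
  rw [e] at h4
  have h5 := nonneg_of_mul_nonneg_left h4 h3
  have h6 := nonneg_of_mul_nonneg_right h5 (mul_pos (h.y_pos q) (h.y_pos (q - 1)))
  linarith

namespace NormalizedSpiral

variable {n k : ℕ} {c : ℝ} {V : ℕ → ℤ → Fin 3 → ℝ} {x y : ℕ → ℤ → ℝ}

/-- A bound on the coordinates at the first `k` levels holds at all levels. -/
theorem forall_of_lt (h : NormalizedSpiral n k c V x y) (hk : 1 ≤ k) {p : ℝ → ℝ → Prop}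
    (hp : ∀ j < k, ∀ q, p (x j q) (y j q)) (j : ℕ) (q : ℤ) : p (x j q) (y j q) := by
  induction j using Nat.strong_induction_on generalizing q with
  | _ j ih =>
    rcases lt_or_ge j k with hj | hj
    · exact hp j hj q
    · obtain ⟨i, rfl⟩ : ∃ i, j = i + k := ⟨j - k, by lia⟩
      rw [h.wrap_x, h.wrap_y]
      exact ih i (by lia) _

theorem one_sub_pos (h : NormalizedSpiral n k c V x y) (j : ℕ) (q : ℤ) :
    0 < 1 - x j q * y j q := sub_pos.2 (h.lt_one j q)

theorem one_sub_lt_one (h : NormalizedSpiral n k c V x y) (j : ℕ) (q : ℤ) :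
    1 - x j q * y j q < 1 :=
  sub_lt_self _ (mul_pos ((h.normalized j).x_pos q) ((h.normalized j).y_pos q))

/-- If the coordinates `x` are at most `1` then all factors of the conserved quantity that belongs
to them are at most `1`, and so it bounds all of them from below. -/
theorem exists_bound_x (h : NormalizedSpiral n k c V x y) (hk : 1 ≤ k) (hx : ∀ q, x 0 q ≤ 1) :
    ∃ ε : ℝ, 0 < ε ∧ (∀ q, ε ≤ x 0 q) ∧ ∀ j q, ε ≤ 1 - x j q * y j q := by
  have hp := h.one_sub_pos
  have hx0 : ∀ j q, 0 < x j q := fun j => (h.normalized j).x_pos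
  set F : ℕ → ℤ → ℝ := fun j q => (1 - x j (q - 1) * y j (q - 1)) * (1 - x j q * y j q) with hF
  have hF0 : ∀ j q, 0 < F j q := fun j q => mul_pos (hp _ _) (hp _ _)
  have hF1 : ∀ j q, F j q ≤ 1 - x j q * y j q := fun j q =>
    mul_le_of_le_one_left (hp _ _).le (h.one_sub_lt_one _ _).le
  have hF2 : ∀ j q, F j q ≤ 1 := fun j q => (hF1 j q).trans (h.one_sub_lt_one _ _).le
  have hcons := conserved_prod (D := x) (F := F) (k := k) (N := n + k) (fun j q => (hx0 j q).ne')
    (fun j q => by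
      rw [h.succ_x, nextX, hF]
      have := (hp j (q + 1)).ne'
      simp only [add_sub_cancel_right]
      field_simp)
    (fun q => by
      have := h.wrap_x 0 q
      rw [zero_add] at this
      rw [this]; congr 1; push_cast; ring)
  set I := (∏ j ∈ Finset.range k, F j 0) * ∏ i ∈ Finset.range (n + k), x 0 (0 + (i : ℤ)) with hI
  have hI0 : 0 < I := mul_pos (Finset.prod_pos fun _ _ => hF0 _ _)
    (Finset.prod_pos fun _ _ => hx0 _ _)
  have hFp : ∀ q, ∏ j ∈ Finset.range k, F j q ≤ 1 := fun q =>
    Finset.prod_le_one (fun _ _ => (hF0 _ _).le) fun _ _ => hF2 _ _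
  have hxp : ∀ q, ∏ i ∈ Finset.range (n + k), x 0 (q + (i : ℤ)) ≤ 1 := fun q =>
    Finset.prod_le_one (fun _ _ => (hx0 _ _).le) fun _ _ => hx _
  refine ⟨I, hI0, fun q => ?_, h.forall_of_lt hk (p := fun x y => I ≤ 1 - x * y)
    fun j hj q => ?_⟩
  · rw [← hcons q]
    calc _ ≤ 1 * ∏ i ∈ Finset.range (n + k), x 0 (q + (i : ℤ)) :=
          mul_le_mul_of_nonneg_right (hFp q) (Finset.prod_nonneg fun _ _ => (hx0 _ _).le)
      _ ≤ x 0 (q + (0 : ℕ)) * 1 ^ _ := by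
          rw [one_mul]
          exact prod_le_mul_pow (f := fun i : ℕ => x 0 (q + i)) le_rfl
            (fun i _ => ⟨hx0 _ _, hx _⟩) (Finset.mem_range.2 (by lia))
      _ = x 0 q := by simp
  · rw [← hcons q]
    calc _ ≤ (∏ j ∈ Finset.range k, F j q) * 1 :=
          mul_le_mul_of_nonneg_left (hxp q) (Finset.prod_nonneg fun _ _ => (hF0 _ _).le)
      _ ≤ F j q * 1 ^ _ := by
          rw [mul_one]
          exact prod_le_mul_pow (f := fun j => F j q) le_rfl
            (fun i _ => ⟨hF0 _ _, hF2 _ _⟩) (Finset.mem_range.2 hj)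
      _ ≤ _ := by rw [one_pow, mul_one]; exact hF1 j q

/-- The second conserved quantity bounds the coordinates `y` from below. -/
theorem exists_bound_y (h : NormalizedSpiral n k c V x y) (hn : 1 ≤ n) {ε : ℝ}
    (hε : 0 < ε) (hx : ∀ q, ε ≤ x 0 q) (hxy : ∀ j q, ε ≤ 1 - x j q * y j q) :
    ∃ δ : ℝ, 0 < δ ∧ ∀ q, δ ≤ y 0 q := by
  have hp := h.one_sub_pos
  have hy0 : ∀ j q, 0 < y j q := fun j => (h.normalized j).y_pos
  have hε1 : ε ≤ 1 := (hxy 0 0).trans (h.one_sub_lt_one 0 0).le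
  set M : ℝ := ε⁻¹ with hM
  have hM1 : 1 ≤ M := (one_le_inv₀ hε).2 hε1
  have hM0 : 0 < M := one_pos.trans_le hM1
  have hyM : ∀ q, y 0 q ≤ M := fun q => by
    rw [hM, ← one_div, le_div_iff₀ hε]
    have h1 := (h.lt_one 0 q).le
    have h2 := mul_le_mul_of_nonneg_right (hx q) (hy0 0 q).le
    linarith
  set F : ℕ → ℤ → ℝ := fun j q =>
    (1 - x j (q - j - 1) * y j (q - j - 1))⁻¹ * (1 - x j (q - j) * y j (q - j))⁻¹ with hF
  have hF0 : ∀ j q, 0 < F j q := fun j q => mul_pos (inv_pos.2 (hp _ _)) (inv_pos.2 (hp _ _))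
  have hF1 : ∀ j q, F j q ≤ M * M := fun j q =>
    mul_le_mul (inv_anti₀ hε (hxy _ _)) (inv_anti₀ hε (hxy _ _)) (inv_pos.2 (hp _ _)).le hM0.le
  have hcons := conserved_prod (D := fun j q => y j (q - j)) (F := F) (k := k) (N := n)
    (fun j q => (hy0 j _).ne')
    (fun j q => by
      simp only [h.succ_y, nextY, hF]
      push_cast
      rw [show q - ((j : ℤ) + 1) + 1 = q - j by ring, show q + 1 - (j : ℤ) - 1 = q - j by ring,
        show q + 1 - (j : ℤ) = q - j + 1 by ring, show q - ((j : ℤ) + 1) = q - j - 1 by ring,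
        show q - (j : ℤ) - 1 + 2 = q - j + 1 by ring]
      have := (hp j (q - j)).ne'
      have := (hp j (q - j + 1)).ne'
      have := (hp j (q - j - 1)).ne'
      field_simp)
    (fun q => by
      have := h.wrap_y 0 (q - k)
      rw [zero_add] at this
      rw [this]; congr 1; push_cast; ring)
  simp only [Nat.cast_zero, sub_zero] at hcons
  set J := (∏ j ∈ Finset.range k, F j 0) * ∏ i ∈ Finset.range n, y 0 (0 + (i : ℤ)) with hJ
  have hJ0 : 0 < J := mul_pos (Finset.prod_pos fun _ _ => hF0 _ _)
    (Finset.prod_pos fun _ _ => hy0 _ _)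
  have hB : 0 < (M * M) ^ k * M ^ n := by positivity
  refine ⟨J / ((M * M) ^ k * M ^ n), div_pos hJ0 hB, fun q => ?_⟩
  rw [div_le_iff₀ hB, ← hcons q]
  have h1 : ∏ j ∈ Finset.range k, F j q ≤ (M * M) ^ k := by
    simpa using Finset.prod_le_prod (s := Finset.range k) (fun j _ => (hF0 j q).le)
      fun j _ => hF1 j q
  have h2 := prod_le_mul_pow (s := Finset.range n) (f := fun i : ℕ => y 0 (q + i)) hM1
    (fun i _ => ⟨hy0 _ _, hyM _⟩) (i := 0) (Finset.mem_range.2 (by lia))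
  simp only [Nat.cast_zero, add_zero, Finset.card_range] at h2
  calc _ ≤ (M * M) ^ k * (y 0 q * M ^ n) :=
        mul_le_mul h1 h2 (Finset.prod_nonneg fun _ _ => (hy0 _ _).le) (by positivity)
    _ = _ := by ring

/-- All coordinates of a spiral and of its iterated pentagram images are bounded away from their
degenerate values. -/
theorem exists_bound (h : NormalizedSpiral n k c V x y) (hn : 1 ≤ n) (hk : 1 ≤ k)
    (hx : ∀ q, x 0 q ≤ 1) :
    ∃ ε : ℝ, 0 < ε ∧ ∀ j q, ε ≤ x j q ∧ ε ≤ y j q ∧ ε ≤ 1 - x j q * y j q := by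
  obtain ⟨ε, hε, h1, h2⟩ := h.exists_bound_x hk hx
  obtain ⟨δ, hδ, h3⟩ := h.exists_bound_y hn hε h1 h2
  have hε1 : ε ≤ 1 := (h2 0 0).trans (h.one_sub_lt_one 0 0).le
  have hp := h.one_sub_pos
  have hr : ∀ a, 0 < a → ∀ j q q', a * ε ≤ a * (1 - x j q * y j q) / (1 - x j q' * y j q') := by
    intro a ha j q q'
    rw [le_div_iff₀ (hp _ _)]
    calc a * ε * (1 - x j q' * y j q') ≤ a * ε * 1 :=
          mul_le_mul_of_nonneg_left (h.one_sub_lt_one j q').le (by positivity)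
      _ ≤ a * (1 - x j q * y j q) := by
          rw [mul_one]; exact mul_le_mul_of_nonneg_left (h2 j q) ha.le
  set m := min ε δ with hm
  have hm0 : 0 < m := lt_min hε hδ
  have key : ∀ j q, m * ε ^ j ≤ x j q ∧ m * ε ^ j ≤ y j q := by
    intro j
    induction j with
    | zero =>
      intro q
      rw [pow_zero, mul_one]
      exact ⟨(min_le_left _ _).trans (h1 q), (min_le_right _ _).trans (h3 q)⟩
    | succ j ih =>
      intro q
      rw [pow_succ, ← mul_assoc, h.succ_x, h.succ_y]
      exact ⟨(mul_le_mul_of_nonneg_right (ih q).1 hε.le).trans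
        (hr _ ((h.normalized j).x_pos q) _ _ _),
        (mul_le_mul_of_nonneg_right (ih (q + 1)).2 hε.le).trans
        (hr _ ((h.normalized j).y_pos (q + 1)) _ _ _)⟩
  have hmk : m * ε ^ k ≤ ε := (mul_le_of_le_one_right hm0.le (pow_le_one₀ hε.le hε1)).trans
    (min_le_left _ _)
  refine ⟨m * ε ^ k, by positivity, h.forall_of_lt hk
    (p := fun x y => m * ε ^ k ≤ x ∧ m * ε ^ k ≤ y ∧ m * ε ^ k ≤ 1 - x * y) fun j hj q => ?_⟩
  have h4 : m * ε ^ k ≤ m * ε ^ j :=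
    mul_le_mul_of_nonneg_left (pow_le_pow_of_le_one hε.le hε1 hj.le) hm0.le
  exact ⟨h4.trans (key j q).1, h4.trans (key j q).2, hmk.trans (h2 j q)⟩

end NormalizedSpiral

/-! ### Strict convexity from weak convexity -/

/-- A closed polygon that is weakly convex and has strictly convex corners is strictly convex. -/
theorem convex_of_nonneg_of_corner {n : ℕ} {a : ℤ → Fin 3 → ℝ} (hp : Function.Periodic a n)
    (h0 : ∀ i j l : ℤ, i < j → j < l → l < i + n → 0 ≤ vol (a i) (a j) (a l))
    (hc : ∀ i, 0 < vol (a (i - 1)) (a i) (a (i + 1)))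
    (i j l : ℤ) (hij : i < j) (hjl : j < l) (hli : l < i + n) : 0 < vol (a i) (a j) (a l) := by
  -- No vertex `a i` lies on the line of an edge `a j, a (j + 1)`: it would have to be in the
  -- wrong place with respect to `a (j - 1)` or `a (j + 2)`.
  have adj : ∀ i j : ℤ, i < j → j + 1 < i + n → 0 < vol (a i) (a j) (a (j + 1)) := by
    intro i j hij hj
    rcases eq_or_lt_of_le (show i + 1 ≤ j by lia) with rfl | h1
    · simpa using hc (i + 1)
    rcases eq_or_lt_of_le (show j + 2 ≤ i + n by lia) with h2 | h2
    · have := hc (j + 1)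
      rwa [add_sub_cancel_right, show j + 1 + 1 = i + n by lia, hp, ← vol_rotate] at this
    refine lt_of_le_of_ne (h0 _ _ _ hij (by lia) hj) fun hz => ?_
    have hD := hc j
    have hD' := hc (j + 1)
    rw [add_sub_cancel_right, show j + 1 + 1 = j + 2 by ring] at hD'
    have w1 := h0 i (j - 1) j (by lia) (by lia) (by lia)
    have w2 := h0 i (j + 1) (j + 2) (by lia) (by lia) (by lia)
    have w3 := h0 i (j - 1) (j + 1) (by lia) (by lia) (by lia)
    have w4 := h0 i j (j + 2) (by lia) (by lia) (by lia)
    have e := vol_smul_eq (a j) (a (j + 1)) (a (j + 2)) (a i)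
    rw [← vol_rotate (a i) (a j) (a (j + 1)), ← hz, zero_smul, add_zero,
      vol_swap_left (a j) (a i)] at e
    have e1 := congrArg (fun x => vol x (a (j - 1)) (a j)) e
    have e3 := congrArg (fun x => vol x (a (j - 1)) (a (j + 1))) e
    simp only [vol_add_left, vol_smul_left, vol_self_outer, mul_zero, zero_add, add_zero] at e1 e3
    rw [vol_rotate (a (j + 1))] at e1
    rw [vol_swap_left (a j) (a (j - 1))] at e3
    have z4 : vol (a i) (a j) (a (j + 2)) = 0 := by nlinarith
    have z2 : vol (a i) (a (j + 1)) (a (j + 2)) = 0 := by nlinarith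
    rw [z4, z2, neg_zero, zero_smul, zero_smul, add_zero, smul_eq_zero] at e
    exact (ne_zero_of_vol_ne_zero (hc i).ne').2.1 (e.resolve_left hD'.ne')
  have hlast : ∀ i j : ℤ, i < j → j < i + n - 1 → 0 < vol (a i) (a j) (a (i + n - 1)) := by
    intro i j hij hj
    have := adj j (i + n - 1) hj (by lia)
    rwa [sub_add_cancel, hp, ← vol_rotate] at this
  rcases eq_or_lt_of_le (show j + 1 ≤ l by lia) with rfl | h1
  · exact adj i j hij hli
  rcases eq_or_lt_of_le (show l ≤ i + n - 1 by lia) with rfl | h2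
  · exact hlast i j hij (by lia)
  have e := vol_plucker (a i) (a j) (a (l - 1)) (a l) (a (i + n - 1))
  have p1 := hlast i j hij (by lia)
  have p2 := adj i (l - 1) (by lia) (by lia)
  have p3 := hlast i (l - 1) (by lia) (by lia)
  have p4 := h0 i j (l - 1) hij (by lia) (by lia)
  have p5 := hlast i l (by lia) (by lia)
  rw [sub_add_cancel] at p2
  have : 0 < vol (a i) (a j) (a l) * vol (a i) (a (l - 1)) (a (i + n - 1)) := by
    rw [e]; positivity
  exact (mul_pos_iff_of_pos_right p3).1 this

theorem Normalized.vol_step {v : ℤ → Fin 3 → ℝ} {x y : ℤ → ℝ} (h : Normalized v x y) (q : ℤ) :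
    vol (v (q + 1)) (v (q + 2)) (v (q + 3))
      = x (q + 1) * y (q + 1) * y q * vol (v q) (v (q + 1)) (v (q + 2)) := by
  have e := h.eq (q + 1)
  rw [show q + 1 + 2 = q + 3 by ring, show q + 1 + 1 = q + 2 by ring, add_sub_cancel_right] at e
  rw [e]
  simp only [vol_eq, Pi.add_apply, Pi.sub_apply, Pi.smul_apply, smul_eq_mul]
  ring

theorem Normalized.vol_pos {v : ℤ → Fin 3 → ℝ} {x y : ℤ → ℝ} (h : Normalized v x y)
    (h0 : 0 < vol (v 0) (v 1) (v 2)) (q : ℤ) : 0 < vol (v q) (v (q + 1)) (v (q + 2)) := by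
  have hz : ∀ q, 0 < x (q + 1) * y (q + 1) * y q := fun q =>
    mul_pos (mul_pos (h.x_pos _) (h.y_pos _)) (h.y_pos _)
  induction q using Int.induction_on with
  | zero => simpa using h0
  | succ i ih =>
    rw [show (i : ℤ) + 1 + 1 = i + 2 by ring, show (i : ℤ) + 1 + 2 = i + 3 by ring, h.vol_step]
    exact mul_pos (hz _) ih
  | pred i ih =>
    have := h.vol_step (-(i : ℤ) - 1)
    rw [show -(i : ℤ) - 1 + 2 = -i + 1 by ring, show -(i : ℤ) - 1 + 3 = -i + 2 by ring,
      sub_add_cancel] at this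
    rw [this] at ih
    rw [sub_add_cancel, show -(i : ℤ) - 1 + 2 = -i + 1 by ring]
    have hz' := hz (-(i : ℤ) - 1)
    rw [sub_add_cancel] at hz'
    exact (mul_pos_iff_of_pos_left hz').1 ih

/-- The pentagram image of a normalized locally convex path is locally convex. -/
theorem Normalized.vol_nextV_pos {v : ℤ → Fin 3 → ℝ} {x y : ℤ → ℝ} (h : Normalized v x y)
    (hlt : ∀ q, x q * y q < 1) (hv : ∀ q, 0 < vol (v q) (v (q + 1)) (v (q + 2))) (q : ℤ) :
    0 < vol (nextV v y q) (nextV v y (q + 1)) (nextV v y (q + 2)) := by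
  have e1 := h.eq (q + 1)
  have e2 := h.eq (q + 2)
  rw [show q + 1 + 2 = q + 3 by ring, show q + 1 + 1 = q + 2 by ring, add_sub_cancel_right] at e1
  rw [show q + 2 + 1 = q + 3 by ring, show q + 2 - 1 = q + 1 by ring] at e2
  have e : vol (nextV v y q) (nextV v y (q + 1)) (nextV v y (q + 2))
      = y q * (1 - x (q + 1) * y (q + 1)) * (y (q + 1) * (1 - x (q + 2) * y (q + 2)))
        * vol (v q) (v (q + 1)) (v (q + 2)) := by
    rw [h.nextV_eq (q + 1), add_sub_cancel_right, show q + 1 + 1 = q + 2 by ring]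
    simp only [nextV]
    rw [e2, e1]
    simp only [vol_eq, Pi.add_apply, Pi.sub_apply, Pi.smul_apply, smul_eq_mul]
    ring
  rw [e]
  have := sub_pos.2 (hlt (q + 1))
  have := sub_pos.2 (hlt (q + 2))
  have := h.y_pos q
  have := h.y_pos (q + 1)
  have := hv q
  positivity

/-! ### A compact family of spirals -/

/-- Normalized lifts of (possibly only weakly convex) spirals of type `(n, k)`, with coordinates
that keep the distance `ε` from their degenerate values, and with the vertices `0, 1, 2` in
standard position. All conditions are closed. -/
structure IsBoundedSpiral (n k : ℕ) (ε c : ℝ) (V : ℕ → ℤ → Fin 3 → ℝ) (x y : ℕ → ℤ → ℝ) :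
    Prop where
  le_x : ∀ j q, ε ≤ x j q
  le_y : ∀ j q, ε ≤ y j q
  le_one_sub : ∀ j q, ε ≤ 1 - x j q * y j q
  eq : ∀ j q, V j (q + 2)
    = V j (q + 1) - y j q • V j q + (x j q * y j q * y j (q - 1)) • V j (q - 1)
  succ : ∀ j q, V (j + 1) q = V j (q + 2) + y j q • V j q
  wrap : ∀ q, V k q = c • V 0 (q + n + k)
  weak : ∀ q i j l : ℤ, i < j → j < l → l < i + n →
    0 ≤ vol (polygon n k V q i) (polygon n k V q j) (polygon n k V q l)
  zero : V 0 0 = ![1, 0, 0]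
  one : V 0 1 = ![0, 1, 0]
  two : V 0 2 = ![0, 0, 1]

namespace IsBoundedSpiral

variable {n k : ℕ} {ε c : ℝ} {V : ℕ → ℤ → Fin 3 → ℝ} {x y : ℕ → ℤ → ℝ}

theorem normalized (h : IsBoundedSpiral n k ε c V x y) (hε : 0 < ε) (j : ℕ) :
    Normalized (V j) (x j) (y j) :=
  ⟨fun q => hε.trans_le (h.le_x j q), fun q => hε.trans_le (h.le_y j q), h.eq j⟩

theorem lt_one (h : IsBoundedSpiral n k ε c V x y) (hε : 0 < ε) (j : ℕ) (q : ℤ) :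
    x j q * y j q < 1 := by
  linarith [h.le_one_sub j q]

theorem vol_pos (h : IsBoundedSpiral n k ε c V x y) (hε : 0 < ε) (j : ℕ) (q : ℤ) :
    0 < vol (V j q) (V j (q + 1)) (V j (q + 2)) := by
  induction j generalizing q with
  | zero =>
    refine (h.normalized hε 0).vol_pos ?_ q
    rw [h.zero, h.one, h.two]
    simp [vol_eq]
  | succ j ih =>
    rw [show V (j + 1) = nextV (V j) (y j) from funext (h.succ j)]
    exact (h.normalized hε j).vol_nextV_pos (h.lt_one hε j) ih q

theorem pathLift (h : IsBoundedSpiral n k ε c V x y) (hε : 0 < ε) (hc : 0 < c) :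
    PathLift n k V := by
  have hx : ∀ j q, 0 < x j q := fun j q => hε.trans_le (h.le_x j q)
  have hy : ∀ j q, 0 < y j q := fun j q => hε.trans_le (h.le_y j q)
  have hw : ∀ j q, V (j + 1) q = V j (q + 1) + (x j q * y j q * y j (q - 1)) • V j (q - 1) := by
    intro j q
    rw [h.succ, h.eq]; module
  refine ⟨fun j _ q => ⟨⟨x j q * y j q * y j (q - 1), 1,
    mul_pos (mul_pos (hx _ _) (hy _ _)) (hy _ _), one_pos, by rw [hw]; module⟩,
    ⟨y j q, 1, hy _ _, one_pos, by rw [h.succ]; module⟩⟩, fun j _ q => ?_,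
    fun q => ⟨c, hc, h.wrap q⟩⟩
  refine ⟨x j (q + 1) * y j (q + 1), 1 - x j (q + 1) * y j (q + 1), mul_pos (hx _ _) (hy _ _),
    sub_pos.2 (h.lt_one hε _ _), ?_⟩
  rw [hw, h.succ j q, add_sub_cancel_right, show q + 1 + 1 = q + 2 by ring]
  module

theorem corner_pos (h : IsBoundedSpiral n k ε c V x y) (hε : 0 < ε) (hc : 0 < c) (hk : 1 ≤ k)
    (hkn : k < n) (q i : ℤ) :
    0 < vol (polygon n k V q (i - 1)) (polygon n k V q i) (polygon n k V q (i + 1)) := by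
  have hV := h.pathLift hε hc
  -- The next vertex of the polygon may be replaced by the next vertex of the path.
  have hnext : ∀ i, 0 < vol (polygon n k V q (i - 1)) (polygon n k V q i)
      (polygon n k V (q + 1) i) →
      0 < vol (polygon n k V q (i - 1)) (polygon n k V q i) (polygon n k V q (i + 1)) := by
    intro i hi
    obtain ⟨s, t, hs, ht, e⟩ := hV.polygon_step hkn q i
    rw [e, vol_add_right, vol_smul_right, vol_smul_right, vol_self_right, mul_zero, zero_add] at hi
    exact (mul_pos_iff_of_pos_left ht).1 hi
  have hlast : ∀ j : ℕ, j ≤ k → 0 < vol (polygon n k V q (n + 1 - j - 1))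
      (polygon n k V q (n + 1 - j)) (polygon n k V q (n + 1 - j + 1)) := by
    intro j hj
    apply hnext
    rw [polygon_last hkn hj, polygon_last hkn hj]
    set r := q - 2 * (j : ℤ) with hr
    rw [show q + 1 - 2 * (j : ℤ) = r + 1 by lia]
    rcases eq_or_lt_of_le hj with rfl | hj
    · rw [show (n : ℤ) + 1 - j - 1 = (n - j - 1) + 1 by ring, polygon_first (by lia) (by lia)]
      have h1 := h.vol_pos hε j (r - 1)
      rw [sub_add_cancel, show r - 1 + 2 = r + 1 by ring] at h1
      refine PosMul.vol_pos ?_ (PosMul.refl _) (PosMul.refl _) h1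
      have h2 := (hV.wrap (r - 1)).symm
      rwa [show r - 1 + n + j = q + (n - j - 1) by lia] at h2
    · rw [show (n : ℤ) + 1 - j - 1 = n + 1 - (j + 1 : ℕ) by push_cast; ring,
        polygon_last hkn hj, show q - 2 * ((j + 1 : ℕ) : ℤ) = r - 2 by push_cast; lia]
      obtain ⟨s, t, hs, ht, e⟩ := (hV.pent j hj (r - 2)).2
      have h1 := h.vol_pos hε j (r - 2)
      have e1 := h.eq j (r - 1)
      rw [show r - 1 + 2 = r + 1 by ring, sub_add_cancel, show r - 1 - 1 = r - 2 by ring] at e1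
      rw [show r - 2 + 1 = r - 1 by ring, show r - 2 + 2 = r by ring] at h1
      rw [show r - 2 + 2 = r by ring] at e
      have h2 : vol (V (j + 1) (r - 2)) (V j r) (V j (r + 1))
          = s * y j (r - 1) * vol (V j (r - 2)) (V j (r - 1)) (V j r) := by
        rw [e, e1]
        simp only [vol_eq, Pi.add_apply, Pi.sub_apply, Pi.smul_apply, smul_eq_mul]
        ring
      rw [h2]
      have := hε.trans_le (h.le_y j (r - 1))
      positivity
  refine polygon_cases (k := k) (p := fun i => 0 < vol (polygon n k V q (i - 1))
    (polygon n k V q i) (polygon n k V q (i + 1))) hkn (fun i => ?_) (fun r h0 hr => ?_)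
    (fun j _ hj => hlast j hj) i
  · rw [show i + n - 1 = i - 1 + n by ring, show i + n + 1 = i + 1 + n by ring,
      polygon_periodic, polygon_periodic, polygon_periodic]
  · rcases eq_or_lt_of_le h0 with rfl | h0
    · have := hlast 0 (by lia)
      rw [← polygon_periodic (V := V) q (0 + 1 - 1), ← polygon_periodic (V := V) q (0 + 1),
        ← polygon_periodic (V := V) q (0 + 1 + 1)]
      convert this using 2 <;> congr 1 <;> push_cast <;> ring
    · apply hnext
      rw [polygon_first h0.le hr, polygon_first h0.le hr, show r + 1 - 1 = r - 1 + 1 by ring,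
        polygon_first (by lia) (by lia)]
      have h1 := h.vol_pos hε 0 (q + (r - 1))
      rwa [show q + (r - 1) + 1 = q + r by ring, show q + (r - 1) + 2 = q + 1 + r by ring] at h1

theorem spiralLift (h : IsBoundedSpiral n k ε c V x y) (hε : 0 < ε) (hc : 0 < c) (hk : 1 ≤ k)
    (hkn : k < n) : SpiralLift n k V :=
  ⟨h.pathLift hε hc, fun q => convex_of_nonneg_of_corner (polygon_periodic q) (h.weak q)
    (h.corner_pos hε hc hk hkn q)⟩

theorem x_le (h : IsBoundedSpiral n k ε c V x y) (hε : 0 < ε) (j : ℕ) (q : ℤ) :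
    x j q ≤ ε⁻¹ := by
  rw [← one_div, le_div_iff₀ hε]
  have h1 := (h.lt_one hε j q).le
  have h2 := mul_le_mul_of_nonneg_left (h.le_y j q) (hε.trans_le (h.le_x j q)).le
  linarith

theorem y_le (h : IsBoundedSpiral n k ε c V x y) (hε : 0 < ε) (j : ℕ) (q : ℤ) :
    y j q ≤ ε⁻¹ := by
  rw [← one_div, le_div_iff₀ hε]
  have h1 := (h.lt_one hε j q).le
  have h2 := mul_le_mul_of_nonneg_right (h.le_x j q) (hε.trans_le (h.le_y j q)).le
  linarith

end IsBoundedSpiral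

/-- The vertices of the lifts in the family are bounded, by the recurrence. -/
theorem exists_bound_of_isBoundedSpiral (n k : ℕ) {ε : ℝ} (hε : 0 < ε) (c : ℝ) :
    ∃ M : ℕ → ℤ → ℝ, ∀ V x y, IsBoundedSpiral n k ε c V x y → ∀ j q, ‖V j q‖ ≤ M j q := by
  have hε' : 0 < ε⁻¹ := inv_pos.2 hε
  suffices H : ∀ j q, ∃ M : ℝ, ∀ V x y, IsBoundedSpiral n k ε c V x y → ‖V j q‖ ≤ M by
    choose M hM using H
    exact ⟨M, fun V x y h j q => hM j q V x y h⟩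
  -- Three consecutive vertices of the path are bounded, by induction in both directions.
  have h0 : ∀ q : ℤ, ∃ M : ℝ, ∀ V x y, IsBoundedSpiral n k ε c V x y →
      ‖V 0 q‖ ≤ M ∧ ‖V 0 (q + 1)‖ ≤ M ∧ ‖V 0 (q + 2)‖ ≤ M := by
    intro q
    induction q using Int.induction_on with
    | zero =>
      refine ⟨1, fun V x y h => ?_⟩
      rw [zero_add, zero_add, h.zero, h.one, h.two]
      refine ⟨?_, ?_, ?_⟩ <;>
      · rw [pi_norm_le_iff_of_nonneg zero_le_one]
        intro i
        fin_cases i <;> simp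
    | succ i ih =>
      obtain ⟨M, hM⟩ := ih
      refine ⟨M + ε⁻¹ * M + ε⁻¹ * M, fun V x y h => ?_⟩
      obtain ⟨h1, h2, h3⟩ := hM V x y h
      have hM0 : 0 ≤ M := (norm_nonneg _).trans h1
      have e := h.eq 0 (i + 1)
      have hy := (hε.trans_le (h.le_y 0 (i + 1))).le
      have hy' := (hε.trans_le (h.le_y 0 i)).le
      have hx := (hε.trans_le (h.le_x 0 (i + 1))).le
      rw [add_sub_cancel_right, show (i : ℤ) + 1 + 1 = i + 2 by ring] at e
      rw [show (i : ℤ) + 1 + 1 = i + 2 by ring]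
      have a1 : 0 ≤ ε⁻¹ * M := by positivity
      refine ⟨by linarith, by linarith, ?_⟩
      rw [e]
      refine (norm_add_le _ _).trans (add_le_add ((norm_sub_le _ _).trans (add_le_add h3 ?_)) ?_)
      · rw [norm_smul, Real.norm_of_nonneg hy]
        exact mul_le_mul (h.y_le hε _ _) h2 (norm_nonneg _) hε'.le
      · rw [norm_smul, Real.norm_of_nonneg (mul_nonneg (mul_nonneg hx hy) hy')]
        refine mul_le_mul ?_ h1 (norm_nonneg _) hε'.le
        exact (mul_le_of_le_one_left hy' (h.lt_one hε _ _).le).trans (h.y_le hε _ _)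
    | pred i ih =>
      obtain ⟨M, hM⟩ := ih
      refine ⟨M + (ε ^ 3)⁻¹ * (M + (M + ε⁻¹ * M)), fun V x y h => ?_⟩
      obtain ⟨h1, h2, h3⟩ := hM V x y h
      have hM0 : 0 ≤ M := (norm_nonneg _).trans h1
      have e := h.eq 0 (-i)
      have hy := h.le_y 0 (-i)
      have hy' := h.le_y 0 (-i - 1)
      have hx := h.le_x 0 (-i)
      set z := x 0 (-i) * y 0 (-i) * y 0 (-i - 1) with hz
      have hz3 : ε ^ 3 ≤ z := by
        rw [hz, pow_succ, pow_two]
        exact mul_le_mul (mul_le_mul hx hy hε.le (hε.le.trans hx)) hy' hε.le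
          (mul_nonneg (hε.le.trans hx) (hε.le.trans hy))
      have hz0 : 0 < z := (pow_pos hε 3).trans_le hz3
      have a1 : 0 ≤ (ε ^ 3)⁻¹ * (M + (M + ε⁻¹ * M)) := by positivity
      rw [sub_add_cancel, show -(i : ℤ) - 1 + 2 = -i + 1 by ring]
      refine ⟨?_, by linarith, by linarith⟩
      have e' : V 0 (-i - 1) = z⁻¹ • (V 0 (-i + 2) - (V 0 (-i + 1) - y 0 (-i) • V 0 (-i))) := by
        rw [e, add_sub_cancel_left, smul_smul, inv_mul_cancel₀ hz0.ne', one_smul]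
      have a2 : ‖V 0 (-i - 1)‖ ≤ (ε ^ 3)⁻¹ * (M + (M + ε⁻¹ * M)) := by
        rw [e', norm_smul, Real.norm_of_nonneg (inv_pos.2 hz0).le]
        refine mul_le_mul (inv_anti₀ (pow_pos hε 3) hz3) ?_ (norm_nonneg _) (by positivity)
        refine (norm_sub_le _ _).trans (add_le_add h3 ((norm_sub_le _ _).trans (add_le_add h2 ?_)))
        rw [norm_smul, Real.norm_of_nonneg (hε.le.trans hy)]
        exact mul_le_mul (h.y_le hε _ _) h1 (norm_nonneg _) hε'.le
      linarith
  intro j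
  induction j with
  | zero =>
    intro q
    obtain ⟨M, hM⟩ := h0 q
    exact ⟨M, fun V x y h => (hM V x y h).1⟩
  | succ j ih =>
    intro q
    obtain ⟨M, hM⟩ := ih q
    obtain ⟨M', hM'⟩ := ih (q + 2)
    refine ⟨M' + ε⁻¹ * M, fun V x y h => ?_⟩
    rw [h.succ]
    refine (norm_add_le _ _).trans (add_le_add (hM' V x y h) ?_)
    rw [norm_smul, Real.norm_of_nonneg (hε.trans_le (h.le_y _ _)).le]
    exact mul_le_mul (h.y_le hε _ _) (hM V x y h) (norm_nonneg _) hε'.le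

/-- The family of all bounded spirals, with fixed bounds. -/
def boundedSpirals (n k : ℕ) (ε c : ℝ) :
    Set ((ℕ → ℤ → Fin 3 → ℝ) × (ℕ → ℤ → ℝ) × (ℕ → ℤ → ℝ)) :=
  {z | IsBoundedSpiral n k ε c z.1 z.2.1 z.2.2}

theorem isCompact_boundedSpirals (n k : ℕ) {ε : ℝ} (hε : 0 < ε) (c : ℝ) :
    IsCompact (boundedSpirals n k ε c) := by
  obtain ⟨M, hM⟩ := exists_bound_of_isBoundedSpiral n k hε c
  have hK : IsCompact ((Set.univ.pi fun j => Set.univ.pi fun q =>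
      Metric.closedBall (0 : Fin 3 → ℝ) (M j q)) ×ˢ
      ((Set.univ.pi fun _ : ℕ => Set.univ.pi fun _ : ℤ => Set.Icc ε ε⁻¹) ×ˢ
      (Set.univ.pi fun _ : ℕ => Set.univ.pi fun _ : ℤ => Set.Icc ε ε⁻¹))) := by
    refine IsCompact.prod ?_ (IsCompact.prod ?_ ?_)
    · exact isCompact_univ_pi fun j => isCompact_univ_pi fun q => isCompact_closedBall _ _
    · exact isCompact_univ_pi fun j => isCompact_univ_pi fun q => isCompact_Icc
    · exact isCompact_univ_pi fun j => isCompact_univ_pi fun q => isCompact_Icc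
  refine hK.of_isClosed_subset ?_ ?_
  · have hpoly : ∀ q i : ℤ, Continuous fun z : (ℕ → ℤ → Fin 3 → ℝ) × (ℕ → ℤ → ℝ) × (ℕ → ℤ → ℝ) =>
        polygon n k z.1 q i := by
      intro q i
      unfold polygon
      split_ifs <;> fun_prop
    have : boundedSpirals n k ε c = {z |
        (∀ j q, ε ≤ z.2.1 j q) ∧ (∀ j q, ε ≤ z.2.2 j q) ∧
        (∀ j q, ε ≤ 1 - z.2.1 j q * z.2.2 j q) ∧
        (∀ j q, z.1 j (q + 2) = z.1 j (q + 1) - z.2.2 j q • z.1 j q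
          + (z.2.1 j q * z.2.2 j q * z.2.2 j (q - 1)) • z.1 j (q - 1)) ∧
        (∀ j q, z.1 (j + 1) q = z.1 j (q + 2) + z.2.2 j q • z.1 j q) ∧
        (∀ q : ℤ, z.1 k q = c • z.1 0 (q + n + k)) ∧
        (∀ q i j l : ℤ, i < j → j < l → l < i + n →
          0 ≤ vol (polygon n k z.1 q i) (polygon n k z.1 q j) (polygon n k z.1 q l)) ∧
        z.1 0 0 = ![1, 0, 0] ∧ z.1 0 1 = ![0, 1, 0] ∧ z.1 0 2 = ![0, 0, 1]} := by
      ext z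
      exact ⟨fun ⟨h1, h2, h3, h4, h5, h6, h7, h8, h9, h10⟩ =>
        ⟨h1, h2, h3, h4, h5, h6, h7, h8, h9, h10⟩,
        fun ⟨h1, h2, h3, h4, h5, h6, h7, h8, h9, h10⟩ =>
        ⟨h1, h2, h3, h4, h5, h6, h7, h8, h9, h10⟩⟩
    rw [this]
    simp only [Set.ofPred_and, Set.ofPred_forall]
    refine IsClosed.inter ?_ <| IsClosed.inter ?_ <| IsClosed.inter ?_ <| IsClosed.inter ?_ <|
      IsClosed.inter ?_ <| IsClosed.inter ?_ <| IsClosed.inter ?_ <| IsClosed.inter ?_ <|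
      IsClosed.inter ?_ ?_
    · exact isClosed_iInter fun j => isClosed_iInter fun q =>
        isClosed_le continuous_const (by fun_prop)
    · exact isClosed_iInter fun j => isClosed_iInter fun q =>
        isClosed_le continuous_const (by fun_prop)
    · exact isClosed_iInter fun j => isClosed_iInter fun q =>
        isClosed_le continuous_const (by fun_prop)
    · exact isClosed_iInter fun j => isClosed_iInter fun q =>
        isClosed_eq (by fun_prop) (by fun_prop)
    · exact isClosed_iInter fun j => isClosed_iInter fun q =>
        isClosed_eq (by fun_prop) (by fun_prop)
    · exact isClosed_iInter fun q => isClosed_eq (by fun_prop) (by fun_prop)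
    · exact isClosed_iInter fun q => isClosed_iInter fun i => isClosed_iInter fun j =>
        isClosed_iInter fun l => isClosed_iInter fun _ => isClosed_iInter fun _ =>
        isClosed_iInter fun _ => isClosed_le continuous_const
          (continuous_vol (hpoly q i) (hpoly q j) (hpoly q l))
    · exact isClosed_eq (by fun_prop) continuous_const
    · exact isClosed_eq (by fun_prop) continuous_const
    · exact isClosed_eq (by fun_prop) continuous_const
  · rintro ⟨V, x, y⟩ h
    have h' : IsBoundedSpiral n k ε c V x y := h
    refine ⟨?_, ?_, ?_⟩
    · intro j _ q _
      rw [mem_closedBall_zero_iff]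
      exact hM V x y h' j q
    · exact fun j _ q _ => ⟨h'.le_x j q, h'.x_le hε j q⟩
    · exact fun j _ q _ => ⟨h'.le_y j q, h'.y_le hε j q⟩

theorem SpiralLift.of_posMul {n k : ℕ} {V W : ℕ → ℤ → Fin 3 → ℝ} (hV : SpiralLift n k V)
    (hkn : k < n) (h : ∀ j ≤ k, ∀ q, PosMul (W j q) (V j q)) : SpiralLift n k W := by
  have hpoly : ∀ q i, PosMul (polygon n k W q i) (polygon n k V q i) := by
    intro q i
    refine polygon_cases (k := k) (p := fun i => PosMul (polygon n k W q i) (polygon n k V q i))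
      hkn (fun i => ?_) (fun r h0 hr => ?_) (fun j _ hj => ?_) i
    · rw [polygon_periodic, polygon_periodic]
    · rw [polygon_first h0 hr, polygon_first h0 hr]; exact h 0 (by lia) _
    · rw [polygon_last hkn hj, polygon_last hkn hj]; exact h j hj _
  refine ⟨⟨fun j hj q => ⟨?_, ?_⟩, fun j hj q => ?_, fun q => ?_⟩, fun q i j l hij hjl hli => ?_⟩
  · exact (h j hj.le _).inOpenCone (h j hj.le _) (h (j + 1) hj _) (hV.pent j hj q).1
  · exact (h j hj.le _).inOpenCone (h j hj.le _) (h (j + 1) hj _) (hV.pent j hj q).2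
  · exact (h (j + 1) hj _).inOpenCone (h j hj.le _) (h (j + 1) hj _) (hV.cut j hj q)
  · exact (h k le_rfl q).trans ((hV.wrap q).trans (h 0 (by lia) _).symm)
  · exact (hpoly q i).vol_pos (hpoly q j) (hpoly q l) (hV.convex q i j l hij hjl hli)

/-- Up to projective transformations, one compact family contains a given spiral with all its
relabelings. -/
theorem SpiralLift.exists_boundedSpirals {n k : ℕ} {V : ℕ → ℤ → Fin 3 → ℝ}
    (hV : SpiralLift n k V) (hn : 4 ≤ n) (hk : 1 ≤ k) (hkn : k < n) :
    ∃ ε c : ℝ, 0 < ε ∧ 0 < c ∧ ∀ m : ℤ, ∃ z ∈ boundedSpirals n k ε c, ∃ g : ProjTrans,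
      ∀ q, PosMul (z.1 0 q) (g (V 0 (q + m))) := by
  obtain ⟨c, W, x, y, hW, hWV⟩ := hV.exists_normalizedSpiral (by lia) hk hkn
  have hWS := hV.of_posMul hkn hWV
  have hvol := fun q => hWS.locallyConvex (by lia) hkn (Nat.zero_le k) q
  obtain ⟨ε, hε, hb⟩ := hW.exists_bound (by lia) hk
    ((hW.normalized 0).x_le_one hvol (hWS.vol_three_four_nonneg hn hkn))
  refine ⟨ε, c, hε, hW.c_pos, fun m => ?_⟩
  have hstd : vol ![1, 0, 0] ![0, 1, 0] ![0, 0, 1] = 1 := by simp [vol_eq]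
  obtain ⟨g, g0, g1, g2⟩ := exists_linearEquiv_of_vol_ne_zero (hvol m).ne'
    (hstd.trans_ne one_ne_zero)
  have hdet : 0 < LinearMap.det g.toLinearMap := by
    have := vol_map g.toLinearMap (W 0 m) (W 0 (m + 1)) (W 0 (m + 2))
    simp only [LinearEquiv.coe_coe] at this
    rw [g0, g1, g2, hstd] at this
    exact (mul_pos_iff_of_pos_right (hvol m)).1 (this ▸ one_pos)
  refine ⟨(fun j q => g (W j (q + m)), fun j q => x j (q + m), fun j q => y j (q + m)), ?_, g,
    fun q => ?_⟩
  · refine ⟨fun j q => (hb _ _).1, fun j q => (hb _ _).2.1, fun j q => (hb _ _).2.2,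
      fun j q => ?_, fun j q => ?_, fun q => ?_, fun q i j l hij hjl hli => ?_, ?_, ?_, ?_⟩
    · simp only
      rw [← map_smul, ← map_smul, ← map_sub, ← map_add]
      congr 1
      exact ((hW.normalized j).shift m).eq q
    · simp only
      rw [← map_smul, ← map_add, hW.succ_V, nextV, show q + m + 2 = q + 2 + m by ring]
    · simp only
      rw [hW.wrap_V, map_smul, show q + m + (n : ℤ) + k = q + n + k + m by ring]
    · have hpoly : ∀ i, polygon n k (fun j q => g (W j (q + m))) q i
          = g.toLinearMap (polygon n k W (q + m) i) := by
        intro i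
        unfold polygon
        rw [LinearEquiv.coe_coe, apply_ite g, add_right_comm, add_sub_right_comm]
      simp only
      rw [hpoly, hpoly, hpoly, vol_map]
      exact (mul_pos hdet (hWS.convex (q + m) i j l hij hjl hli)).le
    · simpa using g0
    · simpa [add_comm] using g1
    · simpa [add_comm] using g2
  · obtain ⟨d, hd, e⟩ := hWV 0 (by lia) (q + m)
    exact ⟨d, hd, by simp only; rw [e, map_smul]⟩

/-! ### Convex polygons in `ℝ³` -/

/-- The volume as a linear form in its last argument; it vanishes on the plane of `u` and `v`. -/
def volForm (u v : Fin 3 → ℝ) : (Fin 3 → ℝ) →ₗ[ℝ] ℝ where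
  toFun := vol u v
  map_add' := vol_add_right u v
  map_smul' c := vol_smul_right c u v

theorem volForm_apply (u v x : Fin 3 → ℝ) : volForm u v x = vol u v x := rfl

section convex

variable {n : ℕ} {a : ℤ → Fin 3 → ℝ}

/-- A convex polygon lies on one side of each of its edges. -/
theorem vol_edge_nonneg (hn : 0 < n) (hp : Function.Periodic a n)
    (hc : ∀ i j l : ℤ, i < j → j < l → l < i + n → 0 < vol (a i) (a j) (a l)) (i l : ℤ) :
    0 ≤ vol (a i) (a (i + 1)) (a l) := by
  have h1 := Int.emod_add_mul_ediv (l - i) n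
  have h2 := Int.emod_nonneg (l - i) (by lia : (n : ℤ) ≠ 0)
  have h3 := Int.emod_lt_of_pos (l - i) (by lia : (0 : ℤ) < n)
  rw [mul_comm] at h1
  have h0 : a l = a (l - (l - i) / n * n) := ((hp.int_mul ((l - i) / n)).sub_eq l).symm
  rw [h0]
  rcases eq_or_lt_of_le h2 with h4 | h4
  · rw [show l - (l - i) / n * n = i by lia, vol_self_outer]
  · exact vol_nonneg_of_convex hp hc (by lia) (by lia) (by lia)

/-- The sum of the forms of two disjoint edges is positive on a convex polygon. -/
theorem vol_add_vol_pos (hn : 4 ≤ n) (hp : Function.Periodic a n)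
    (hc : ∀ i j l : ℤ, i < j → j < l → l < i + n → 0 < vol (a i) (a j) (a l)) (i : ℤ) :
    0 < vol (a 1) (a 2) (a i) + vol (a 3) (a 4) (a i) := by
  have h1 := Int.emod_add_mul_ediv (i - 1) n
  have h2 := Int.emod_nonneg (i - 1) (by lia : (n : ℤ) ≠ 0)
  have h3 := Int.emod_lt_of_pos (i - 1) (by lia : (0 : ℤ) < n)
  rw [mul_comm] at h1
  have h0 : a i = a (i - (i - 1) / n * n) := ((hp.int_mul ((i - 1) / n)).sub_eq i).symm
  have n1 := vol_edge_nonneg (by lia) hp hc 1 i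
  have n2 := vol_edge_nonneg (by lia) hp hc 3 i
  rw [show (1 : ℤ) + 1 = 2 by norm_num] at n1
  rw [show (3 : ℤ) + 1 = 4 by norm_num] at n2
  rcases le_or_gt 2 ((i - 1) % n) with h4 | h4
  · refine add_pos_of_pos_of_nonneg ?_ n2
    rw [h0]
    exact hc _ _ _ (by lia) (by lia) (by lia)
  · refine add_pos_of_nonneg_of_pos n1 ?_
    rw [h0, ← hp (i - _)]
    exact hc _ _ _ (by lia) (by lia) (by lia)

/-- The linear chart in which a convex polygon lies in the half-space of positive last
coordinate. -/
def polygonChart (a : ℤ → Fin 3 → ℝ) : (Fin 3 → ℝ) →ₗ[ℝ] Fin 3 → ℝ where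
  toFun x := ![vol x (a 2) (a 3), vol (a 1) x (a 3), vol (a 1) (a 2) x + vol (a 3) (a 4) x]
  map_add' x y := by
    ext i
    fin_cases i <;> simp [vol_add_left, vol_add_mid, vol_add_right]
    ring
  map_smul' c x := by
    ext i
    fin_cases i <;> simp [vol_smul_left, vol_smul_mid, vol_smul_right]
    ring

theorem det_polygonChart (h : vol (a 1) (a 2) (a 3) ≠ 0) :
    LinearMap.det (polygonChart a) = vol (a 1) (a 2) (a 3) ^ 2 := by
  have h1 := vol_map (polygonChart a) (a 1) (a 2) (a 3)
  have h2 : vol (polygonChart a (a 1)) (polygonChart a (a 2)) (polygonChart a (a 3))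
      = vol (a 1) (a 2) (a 3) ^ 3 := by
    rw [vol_eq]
    simp [polygonChart, vol_self_left, vol_self_right, vol_self_outer]
    ring
  rw [h2] at h1
  refine mul_right_cancel₀ h ?_
  rw [← h1]; ring

/-- Lifts that form a convex polygon determine a seed. -/
theorem isSeed_of_convex {k : ℕ} (hn : 4 ≤ n) (hkn : k < n) (hp : Function.Periodic a n)
    (hc : ∀ i j l : ℤ, i < j → j < l → l < i + n → 0 < vol (a i) (a j) (a l))
    {b : ℤ → Fin 3 → ℝ}
    (hb : ∀ j : ℤ, n - k < j → j ≤ n → InOpenCone (a j) (a (j + 1)) (b j))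
    {S : SeedPoints} (hA : ∀ i : ℕ, ∃ h : a i ≠ 0, S.A i = Projectivization.mk ℝ (a i) h)
    (hB : ∀ j : ℕ, ∃ h : b j ≠ 0, S.B j = Projectivization.mk ℝ (b j) h) : IsSeed n k S := by
  have hD : 0 < vol (a 1) (a 2) (a 3) := hc _ _ _ (by lia) (by lia) (by lia)
  set G := polygonChart a with hG
  have hdet : 0 < LinearMap.det G := by rw [hG, det_polygonChart hD.ne']; positivity
  set g : ProjTrans := LinearEquiv.ofIsUnitDet (f := G) (v := Pi.basisFun ℝ (Fin 3))
    (v' := Pi.basisFun ℝ (Fin 3)) (by rw [LinearMap.det_toMatrix]; exact hdet.ne'.isUnit) with hg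
  have hgG : ∀ x, g x = G x := fun x => rfl
  let p : (Fin 3 → ℝ) → ℝ × ℝ := fun x => (G x 0 / G x 2, G x 1 / G x 2)
  have hpos : ∀ i, 0 < G (a i) 2 := fun i => vol_add_vol_pos hn hp hc i
  have hmk : ∀ x (h : x ≠ 0), 0 < G x 2 →
      g • (Projectivization.mk ℝ x h : RP2) = affinePt (p x) := by
    intro x h hx
    rw [Projectivization.smul_mk, affinePt, Projectivization.mk_eq_mk_iff']
    refine ⟨G x 2, ?_⟩
    change _ = G x
    ext i
    fin_cases i <;> simp [p] <;> field_simp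
  have hor : ∀ u v w, 0 < G u 2 → 0 < G v 2 → 0 < G w 2 → 0 < vol u v w →
      0 < orient (p u) (p v) (p w) := by
    intro u v w hu hv hw h
    have h1 := vol_map G u v w
    have h2 : orient (p u) (p v) (p w) = vol (G u) (G v) (G w) / (G u 2 * G v 2 * G w 2) := by
      have := hu.ne'
      have := hv.ne'
      have := hw.ne'
      simp only [orient, p, vol_eq]
      field_simp
      ring
    rw [h2, h1]
    positivity
  have hbpos : ∀ j : ℤ, n - k < j → j ≤ n → 0 < G (b j) 2 := by
    intro j h1 h2
    obtain ⟨s, t, hs, ht, e⟩ := hb j h1 h2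
    rw [e, map_add, map_smul, map_smul]
    have := hpos j
    have := hpos (j + 1)
    simp only [Pi.add_apply, Pi.smul_apply, smul_eq_mul]
    positivity
  refine ⟨g, fun i => p (a i), fun j => p (b j), fun i h1 h2 => ?_, fun j h1 h2 => ?_,
    fun i j l h1 hij hjl hl => ?_, fun j h1 h2 => ?_⟩
  · obtain ⟨h, e⟩ := hA i
    rw [e, hmk _ _ (hpos i)]
  · obtain ⟨h, e⟩ := hB j
    rw [e, hmk _ _ (hbpos j (by lia) (by lia))]
  · exact hor _ _ _ (hpos _) (hpos _) (hpos _) (hc _ _ _ (by lia) (by lia) (by lia))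
  · obtain ⟨s, t, hs, ht, e⟩ := hb j (by lia) (by lia)
    have hj := hpos j
    have hj' := hpos (j + 1)
    have hbj := hbpos j (by lia) (by lia)
    have e1 : a ((j % n + 1 : ℕ) : ℤ) = a (j + 1) := by
      rcases eq_or_lt_of_le h2 with rfl | h3
      · rw [Nat.mod_self, add_comm (j : ℤ), hp]; rfl
      · rw [Nat.mod_eq_of_lt h3]; rfl
    have e2 : ∀ i, G (b j) i = s * G (a j) i + t * G (a (j + 1)) i := fun i => by
      rw [e, map_add, map_smul, map_smul]; rfl
    refine ⟨s * G (a j) 2 / G (b j) 2, t * G (a (j + 1)) 2 / G (b j) 2, by positivity,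
      by positivity, ?_, ?_⟩
    · rw [← add_div, ← e2, div_self hbj.ne']
    · simp only [e1]
      have := hj.ne'
      have := hj'.ne'
      have := hbj.ne'
      ext
      · simp only [p, Prod.fst_add, Prod.smul_fst, smul_eq_mul]
        rw [e2 0]
        field_simp
      · simp only [p, Prod.snd_add, Prod.smul_snd, smul_eq_mul]
        rw [e2 1]
        field_simp

end convex

/-! ### Spirals from lifts -/

namespace SpiralLift

variable {n k : ℕ} {V : ℕ → ℤ → Fin 3 → ℝ}

theorem polygon_ne_zero (hV : SpiralLift n k V) (hn : 3 ≤ n) (q i : ℤ) :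
    polygon n k V q i ≠ 0 :=
  (ne_zero_of_vol_ne_zero
    (hV.convex q i (i + 1) (i + 2) (by lia) (by lia) (by lia)).ne').1

/-- The new points of the seed map are the meets that its definition prescribes. -/
theorem mk_eq_meet (hV : SpiralLift n k V) (hn : 3 ≤ n) (hkn : k < n) (q j : ℤ)
    (h1 : n - k < j) (h2 : j ≤ n) :
    (Projectivization.mk ℝ (polygon n k V (q + 2) j) (hV.polygon_ne_zero hn _ _) : RP2)
      = meet (Projectivization.mk ℝ (polygon n k V q (j + 1)) (hV.polygon_ne_zero hn _ _))
        (Projectivization.mk ℝ (polygon n k V (q + 2) (j + 1)) (hV.polygon_ne_zero hn _ _))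
        (Projectivization.mk ℝ (polygon n k V (q + 1) j) (hV.polygon_ne_zero hn _ _))
        (Projectivization.mk ℝ (polygon n k V (q + 1) (j + 1)) (hV.polygon_ne_zero hn _ _)) := by
  obtain ⟨m, rfl⟩ : ∃ m : ℕ, j = n + 1 - (m + 1 : ℕ) := ⟨(n - j).toNat, by lia⟩
  have hq : q + 1 + 1 = q + 2 := by ring
  have c1 := hV.polygon_cut hkn (q := q) (j := m + 1) (by lia) (by lia)
  have c2 := hV.polygon_cut hkn (q := q + 1) (j := m + 1) (by lia) (by lia)
  have st := hV.toPathLift.polygon_step hkn (q + 1)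
  rw [hq] at c2 st
  obtain ⟨v1, v2, -⟩ := vol_pos_of_two_steps hn (hV.convex q) (hV.convex (q + 1))
    (hV.toPathLift.polygon_step hkn q) st _ c1
  refine (mk_eq_meet_iff _ _ _ _ _ ?_ ?_).2 ⟨?_, ?_⟩
  · rw [vol_swap_right]; exact (neg_neg_of_pos v1).ne
  · rw [vol_rotate, vol_swap_left]; exact (neg_neg_of_pos v2).ne
  · obtain ⟨s, t, -, -, e⟩ := (hV.pent m (by lia) (q - 2 * m)).2
    have e1 : (n : ℤ) + 1 - (m + 1 : ℕ) + 1 = n + 1 - m := by push_cast; ring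
    rw [e1, polygon_last hkn (by lia), polygon_last hkn (by lia), polygon_last hkn (by lia),
      show q + 2 - 2 * ((m + 1 : ℕ) : ℤ) = q - 2 * m by push_cast; ring,
      show q + 2 - 2 * (m : ℤ) = q - 2 * m + 2 by ring, e]
    simp only [vol_add_right, vol_smul_right, vol_self_right, vol_self_outer]
    ring
  · obtain ⟨s, t, -, -, e⟩ := c2
    rw [e]
    simp only [vol_add_right, vol_smul_right, vol_self_right, vol_self_outer]
    ring

theorem isGeneratedBySeed (hV : SpiralLift n k V) (hn : 4 ≤ n) (hk : 1 ≤ k) (hkn : k < n)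
    {P : ℤ → RP2} (hP : ∀ q, ∃ h : V 0 q ≠ 0, P q = Projectivization.mk ℝ (V 0 q) h) :
    IsGeneratedBySeed n k P := by
  have hne := fun q i => hV.polygon_ne_zero (by lia) q i
  have hcut : ∀ q j : ℤ, n - k < j → j ≤ n → InOpenCone (polygon n k V q j)
      (polygon n k V q (j + 1)) (polygon n k V (q + 1) j) := by
    intro q j h1 h2
    obtain ⟨m, rfl⟩ : ∃ m : ℕ, j = n + 1 - m := ⟨(n + 1 - j).toNat, by lia⟩
    exact hV.polygon_cut hkn (by lia) (by lia)
  have hshift : ∀ q (i : ℕ), 1 ≤ i → i + k ≤ n →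
      (Projectivization.mk ℝ (polygon n k V (q + 1) i) (hne _ _) : RP2)
        = Projectivization.mk ℝ (polygon n k V q (i + 1 : ℕ)) (hne _ _) := by
    intro q i h1 h2
    have h3 := hV.polygon_shift hkn (q := q) (r := i - 1) (by lia) (by lia)
    rw [sub_add_cancel] at h3
    exact h3.mk_eq _ _
  have hmod : ∀ q, polygon n k V q (n + 1) = polygon n k V q 1 := fun q => by
    rw [add_comm, polygon_periodic]
  refine ⟨fun q => ⟨fun i => Projectivization.mk ℝ (polygon n k V q i) (hne _ _),
    fun j => Projectivization.mk ℝ (polygon n k V (q + 1) j) (hne _ _)⟩, fun q => ?_, fun q => ?_,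
    fun q => ?_⟩
  · exact isSeed_of_convex hn hkn (polygon_periodic q) (hV.convex q) (hcut q)
      (fun i => ⟨hne _ _, rfl⟩) (fun j => ⟨hne _ _, rfl⟩)
  · have hq : q + 1 + 1 = q + 2 := by ring
    refine ⟨fun i h1 h2 => hshift q i h1 h2, fun i h1 h2 => rfl, ?_, fun j h1 h2 => ?_⟩
    · have h1 := hV.mk_eq_meet (by lia) hkn q n (by lia) le_rfl
      have h2 := hshift (q + 1) 1 le_rfl (by lia)
      simp only [hmod] at h1
      simp only [hq] at h2 ⊢
      rw [h1]
      congr 1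
    · have h3 := hV.mk_eq_meet (by lia) hkn q j (by lia) (by lia)
      simp only [hq]
      exact h3
  · obtain ⟨h, e⟩ := hP q
    rw [e]
    congr 1
    exact (polygon_one hkn).symm

/-- A linear form that is nonnegative on a seed is nonnegative on all later ones. -/
theorem nonneg_of_le (hV : SpiralLift n k V) (hkn : k < n) {f : (Fin 3 → ℝ) →ₗ[ℝ] ℝ} {q q' : ℤ}
    (hq : q ≤ q') (h : ∀ i, 0 ≤ f (polygon n k V q i)) (i : ℤ) : 0 ≤ f (polygon n k V q' i) := by
  induction q', hq using Int.leInduction generalizing i with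
  | base => exact h i
  | succ q' _ ih =>
    obtain ⟨s, t, hs, ht, e⟩ := hV.toPathLift.polygon_step hkn q' i
    rw [e, map_add, map_smul, map_smul]
    exact add_nonneg (mul_nonneg hs (ih i)) (mul_nonneg ht.le (ih (i + 1)))

theorem mem_halfOpenEdge (hkn : k < n) {j : ℕ} (hj : j ≤ k) {q : ℤ} {X : RP2}
    (hX : X ∈ halfOpenEdge (V j) q) : ∃ s t : ℝ, 0 < s ∧ 0 ≤ t ∧
      ∃ h : s • polygon n k V (q + 2 * j) (n + 1 - j)
        + t • polygon n k V (q + 2 * j + 1) (n + 1 - j) ≠ 0, X = Projectivization.mk ℝ _ h := by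
  obtain ⟨s, t, hs, ht, h, e⟩ := hX
  rw [polygon_last hkn hj, polygon_last hkn hj, show q + 2 * (j : ℤ) - 2 * j = q by ring,
    show q + 2 * (j : ℤ) + 1 - 2 * j = q + 1 by ring]
  exact ⟨s, t, hs, ht, h, e⟩

/-- An edge of a path that is cut off from the seed at time `q + 2 j` is disjoint from the edges
that are cut off later: the line of the new edge of the next seed separates them. -/
theorem disjoint_of_lt (hV : SpiralLift n k V) (hn : 4 ≤ n) (hkn : k < n) {j j' : ℕ} (hj : j < k)
    (hj' : j' < k) {q q' : ℤ} (h : q + 2 * j < q' + 2 * j') :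
    Disjoint (halfOpenEdge (V j) q) (halfOpenEdge (V j') q') := by
  rw [Set.disjoint_left]
  intro X hX hX'
  obtain ⟨s, t, hs, ht, hne, rfl⟩ := mem_halfOpenEdge hkn hj.le hX
  obtain ⟨s', t', hs', ht', hne', e⟩ := mem_halfOpenEdge hkn hj'.le hX'
  rw [Projectivization.mk_eq_mk_iff'] at e
  obtain ⟨c, hc⟩ := e
  set τ := q + 2 * (j : ℤ) with hτ
  set τ' := q' + 2 * (j' : ℤ) with hτ'
  set i : ℤ := n + 1 - j with hi
  set i' : ℤ := n + 1 - j' with hi'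
  -- The form `f` is positive on the whole seed, and excludes a negative factor `c`.
  set f := volForm (polygon n k V τ 1) (polygon n k V τ 2)
    + volForm (polygon n k V τ 3) (polygon n k V τ 4) with hf
  have f0 : ∀ l, 0 < f (polygon n k V τ l) :=
    vol_add_vol_pos hn (polygon_periodic τ) (hV.convex τ)
  have f1 : ∀ l, 0 ≤ f (polygon n k V (τ + 1) l) :=
    hV.nonneg_of_le hkn (by lia) fun l => (f0 l).le
  have f2 : ∀ l, 0 ≤ f (polygon n k V τ' l) := hV.nonneg_of_le hkn h.le fun l => (f0 l).le
  have f3 : ∀ l, 0 ≤ f (polygon n k V (τ' + 1) l) :=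
    hV.nonneg_of_le hkn (by lia) fun l => (f0 l).le
  have hcpos : 0 < c := by
    have h1 := congrArg f hc
    simp only [map_add, map_smul, smul_eq_mul] at h1
    have h2 := mul_pos hs (f0 i)
    have h3 := mul_nonneg ht (f1 i)
    have h4 := mul_nonneg hs'.le (f2 i')
    have h5 := mul_nonneg ht' (f3 i')
    by_contra h6
    nlinarith [mul_nonneg (neg_nonneg.2 (not_lt.1 h6)) (add_nonneg h4 h5)]
  -- The form `g` vanishes on the edge that cuts off the corner `i`.
  set g := volForm (polygon n k V (τ + 1) (i - 1)) (polygon n k V (τ + 1) i) with hg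
  have g1 : ∀ l, 0 ≤ g (polygon n k V (τ + 1) l) := by
    intro l
    have := vol_edge_nonneg (by lia) (polygon_periodic (τ + 1)) (hV.convex (τ + 1)) (i - 1) l
    rwa [sub_add_cancel] at this
  have g2 : ∀ l, 0 ≤ g (polygon n k V τ' l) := hV.nonneg_of_le hkn (by lia) g1
  have g3 : ∀ l, 0 ≤ g (polygon n k V (τ' + 1) l) := hV.nonneg_of_le hkn (by lia) g1
  have g0 : g (polygon n k V τ i) < 0 := by
    obtain ⟨a, b, ha, hb, e1⟩ := hV.polygon_cut hkn (q := τ) (j := j + 1) (by lia) (by lia)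
    obtain ⟨a', b', ha', hb', e2⟩ := hV.toPathLift.polygon_step hkn τ i
    rw [show (n : ℤ) + 1 - (j + 1 : ℕ) = i - 1 by push_cast; lia, sub_add_cancel] at e1
    rw [hg, volForm_apply, e1, e2]
    have := hV.convex τ (i - 1) i (i + 1) (by lia) (by lia) (by lia)
    simp only [vol_add_left, vol_smul_left, vol_add_mid, vol_smul_mid, vol_self_right,
      vol_self_outer]
    rw [vol_swap_right]
    simp only [mul_zero, zero_add, add_zero]
    have : 0 < a * (b' * vol (polygon n k V τ (i - 1)) (polygon n k V τ i)
      (polygon n k V τ (i + 1))) := by positivity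
    nlinarith
  have g4 : g (polygon n k V (τ + 1) i) = 0 := vol_self_right _ _
  have h1 := congrArg g hc
  simp only [map_add, map_smul, smul_eq_mul, g4, mul_zero, add_zero] at h1
  have h2 := mul_neg_of_pos_of_neg hs g0
  have h3 := mul_nonneg hcpos.le
    (add_nonneg (mul_nonneg hs'.le (g2 i')) (mul_nonneg ht' (g3 i')))
  linarith

/-- Edges that are cut off at the same time lie on different edges of a seed. -/
theorem disjoint_of_eq (hV : SpiralLift n k V) (hn : 4 ≤ n) (hkn : k < n) {j j' : ℕ} (hj : j < k)
    (hj' : j' < j) {q q' : ℤ} (h : q + 2 * j = q' + 2 * j') :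
    Disjoint (halfOpenEdge (V j) q) (halfOpenEdge (V j') q') := by
  rw [Set.disjoint_left]
  intro X hX hX'
  obtain ⟨s, t, hs, ht, hne, rfl⟩ := mem_halfOpenEdge hkn hj.le hX
  obtain ⟨s', t', hs', ht', hne', e⟩ := mem_halfOpenEdge hkn (hj'.trans hj).le hX'
  rw [Projectivization.mk_eq_mk_iff'] at e
  obtain ⟨c, hc⟩ := e
  rw [← h] at hc
  set τ := q + 2 * (j : ℤ) with hτ
  set i : ℤ := n + 1 - j with hi
  set i' : ℤ := n + 1 - j' with hi'
  set g := volForm (polygon n k V τ i') (polygon n k V τ (i' + 1)) with hg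
  have g0 : ∀ l, 0 ≤ g (polygon n k V τ l) := fun l =>
    vol_edge_nonneg (by lia) (polygon_periodic τ) (hV.convex τ) i' l
  have g1 : ∀ l, 0 ≤ g (polygon n k V (τ + 1) l) := hV.nonneg_of_le hkn (by lia) g0
  have g2 : g (polygon n k V τ i') = 0 := vol_self_outer _ _
  have g3 : g (polygon n k V (τ + 1) i') = 0 := by
    obtain ⟨a, b, ha, hb, e1⟩ := hV.toPathLift.polygon_step hkn τ i'
    rw [e1, map_add, map_smul, map_smul, g2, show g (polygon n k V τ (i' + 1)) = 0 from
      vol_self_right _ _, smul_zero, smul_zero, add_zero]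
  have g4 : 0 < g (polygon n k V τ i) := by
    have := hV.convex τ i i' (i' + 1) (by lia) (by lia) (by lia)
    rwa [vol_rotate] at this
  have h1 := congrArg g hc
  simp only [map_add, map_smul, smul_eq_mul, g2, g3, mul_zero, add_zero] at h1
  have h2 := mul_pos hs g4
  have h3 := mul_nonneg ht (g1 i)
  linarith

theorem isPLCSpiral (hV : SpiralLift n k V) (hn : 4 ≤ n) (hkn : k < n) {P : ℤ → RP2}
    (hP : ∀ q, ∃ h : V 0 q ≠ 0, P q = Projectivization.mk ℝ (V 0 q) h) : IsPLCSpiral n k P := by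
  refine ⟨V, hP, hV.pent, hV.wrap, fun j hj q => hV.locallyConvex (by lia) hkn hj.le q,
    fun j hj j' hj' q q' hne => ?_⟩
  rcases lt_trichotomy (q + 2 * (j : ℤ)) (q' + 2 * j') with h | h | h
  · exact hV.disjoint_of_lt hn hkn hj hj' h
  · rcases lt_trichotomy j j' with h1 | h1 | h1
    · exact (hV.disjoint_of_eq hn hkn hj' h1 h.symm).symm
    · subst h1
      exact absurd (congrArg (Prod.mk j) (add_right_cancel h)) hne
    · exact hV.disjoint_of_eq hn hkn hj h1 h
  · exact (hV.disjoint_of_lt hn hkn hj' hj h).symm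

end SpiralLift

/-! ### The space of spirals is Hausdorff -/

/-- The projection from the nonzero vectors to the projective plane is open, and so it induces the
product topology on sequences of points, too. -/
theorem isOpenQuotientMap_mk : IsOpenQuotientMap
    (fun v : {v : Fin 3 → ℝ // v ≠ 0} => (Projectivization.mk ℝ v.1 v.2 : RP2)) := by
  refine ⟨fun X => ⟨⟨X.rep, X.rep_nonzero⟩, X.mk_rep⟩, continuous_coinduced_rng, fun U hU => ?_⟩
  rw [isOpen_coinduced]
  -- The saturation of `U` is the union of the multiples of `U`.
  have h1 : (fun v : {v : Fin 3 → ℝ // v ≠ 0} => (Projectivization.mk ℝ v.1 v.2 : RP2)) ⁻¹'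
      ((fun v : {v : Fin 3 → ℝ // v ≠ 0} => (Projectivization.mk ℝ v.1 v.2 : RP2)) '' U)
      = ⋃ c : {c : ℝ // c ≠ 0}, (fun v : {v : Fin 3 → ℝ // v ≠ 0} =>
        (⟨c.1 • v.1, smul_ne_zero c.2 v.2⟩ : {v : Fin 3 → ℝ // v ≠ 0})) ⁻¹' U := by
    ext v
    simp only [Set.mem_preimage, Set.mem_image, Set.mem_iUnion]
    constructor
    · rintro ⟨u, hu, e⟩
      obtain ⟨c, hc⟩ := (Projectivization.mk_eq_mk_iff' ℝ _ _ _ _).1 e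
      have hc0 : c ≠ 0 := by rintro rfl; exact u.2 (by rw [← hc, zero_smul])
      refine ⟨⟨c, hc0⟩, ?_⟩
      convert hu
    · rintro ⟨c, hc⟩
      exact ⟨_, hc, (Projectivization.mk_eq_mk_iff' ℝ _ _ _ _).2 ⟨c.1, rfl⟩⟩
  rw [h1]
  exact isOpen_iUnion fun c => hU.preimage (by fun_prop)

/-- The coordinate `x` of a path, as a ratio of volumes of arbitrary lifts of its vertices. -/
def invX (p : ℤ → Fin 3 → ℝ) (q : ℤ) : ℝ :=
  vol (p (q - 2)) (p (q - 1)) (p (q + 1)) * vol (p q) (p (q + 1)) (p (q + 2)) /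
    (vol (p (q - 2)) (p q) (p (q + 1)) * vol (p (q - 1)) (p (q + 1)) (p (q + 2)))

/-- The coordinate `y` of a path, as a ratio of volumes of arbitrary lifts of its vertices. -/
def invY (p : ℤ → Fin 3 → ℝ) (q : ℤ) : ℝ :=
  vol (p (q - 1)) (p (q + 1)) (p (q + 2)) * vol (p (q - 2)) (p (q - 1)) (p q) /
    (vol (p (q - 2)) (p (q - 1)) (p (q + 1)) * vol (p (q - 1)) (p q) (p (q + 2)))

theorem invX_smul {c : ℤ → ℝ} (hc : ∀ q, c q ≠ 0) (p : ℤ → Fin 3 → ℝ) (q : ℤ) :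
    invX (fun q => c q • p q) q = invX p q := by
  simp only [invX, vol_smul_left, vol_smul_mid, vol_smul_right]
  refine Eq.trans ?_ (mul_div_mul_left _ _
    (show c (q - 2) * c (q - 1) * c q * c (q + 1) ^ 2 * c (q + 2) ≠ 0 by
    simp [hc]))
  congr 1 <;> ring

theorem invY_smul {c : ℤ → ℝ} (hc : ∀ q, c q ≠ 0) (p : ℤ → Fin 3 → ℝ) (q : ℤ) :
    invY (fun q => c q • p q) q = invY p q := by
  simp only [invY, vol_smul_left, vol_smul_mid, vol_smul_right]
  refine Eq.trans ?_ (mul_div_mul_left _ _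
    (show c (q - 2) * c (q - 1) ^ 2 * c q * c (q + 1) * c (q + 2) ≠ 0 by
    simp [hc]))
  congr 1 <;> ring

theorem Normalized.vol_skip_last {v : ℤ → Fin 3 → ℝ} {x y : ℤ → ℝ} (h : Normalized v x y)
    (q : ℤ) : vol (v (q - 1)) (v q) (v (q + 2)) = vol (v (q - 1)) (v q) (v (q + 1)) := by
  rw [h.eq]
  simp only [vol_eq, Pi.add_apply, Pi.sub_apply, Pi.smul_apply, smul_eq_mul]
  ring

theorem Normalized.vol_skip_first {v : ℤ → Fin 3 → ℝ} {x y : ℤ → ℝ} (h : Normalized v x y)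
    (q : ℤ) : vol (v (q - 1)) (v (q + 1)) (v (q + 2))
      = y q * vol (v (q - 1)) (v q) (v (q + 1)) := by
  rw [h.eq]
  simp only [vol_eq, Pi.add_apply, Pi.sub_apply, Pi.smul_apply, smul_eq_mul]
  ring

theorem Normalized.invX_eq {v : ℤ → Fin 3 → ℝ} {x y : ℤ → ℝ} (h : Normalized v x y)
    (hv : ∀ q, vol (v q) (v (q + 1)) (v (q + 2)) ≠ 0) (q : ℤ) : invX v q = x q := by
  have h1 := h.vol_skip_last (q - 1)
  have h2 := h.vol_skip_first (q - 1)
  have h3 := h.vol_step (q - 1)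
  have n1 := hv (q - 2)
  have n2 := hv (q - 1)
  rw [show q - 2 + 1 = q - 1 by ring, show q - 2 + 2 = q by ring] at n1
  rw [sub_add_cancel, show q - 1 + 2 = q + 1 by ring] at n2
  rw [show q - 1 - 1 = q - 2 by ring, show q - 1 + 2 = q + 1 by ring, sub_add_cancel] at h1 h2
  rw [sub_add_cancel, show q - 1 + 2 = q + 1 by ring, show q - 1 + 3 = q + 2 by ring] at h3
  rw [invX, h1, h2, h3, h.vol_skip_first q]
  have := (h.y_pos q).ne'
  have := (h.y_pos (q - 1)).ne'
  field_simp

theorem Normalized.invY_eq {v : ℤ → Fin 3 → ℝ} {x y : ℤ → ℝ} (h : Normalized v x y)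
    (hv : ∀ q, vol (v q) (v (q + 1)) (v (q + 2)) ≠ 0) (q : ℤ) : invY v q = y q := by
  have h1 := h.vol_skip_last (q - 1)
  have n1 := hv (q - 2)
  have n2 := hv (q - 1)
  rw [show q - 2 + 1 = q - 1 by ring, show q - 2 + 2 = q by ring] at n1
  rw [sub_add_cancel, show q - 1 + 2 = q + 1 by ring] at n2
  rw [show q - 1 - 1 = q - 2 by ring, show q - 1 + 2 = q + 1 by ring, sub_add_cancel] at h1
  rw [invY, h1, h.vol_skip_first q, h.vol_skip_last q]
  field_simp

theorem Normalized.map {v : ℤ → Fin 3 → ℝ} {x y : ℤ → ℝ} (h : Normalized v x y)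
    (g : (Fin 3 → ℝ) →ₗ[ℝ] Fin 3 → ℝ) : Normalized (fun q => g (v q)) x y :=
  ⟨h.x_pos, h.y_pos, fun q => by rw [h.eq, map_add, map_sub, map_smul, map_smul]⟩

/-- A normalized path is determined by its coordinates and three consecutive vertices. -/
theorem Normalized.ext {v w : ℤ → Fin 3 → ℝ} {x y : ℤ → ℝ} (h : Normalized v x y)
    (h' : Normalized w x y) (h0 : v 0 = w 0) (h1 : v 1 = w 1) (h2 : v 2 = w 2) (q : ℤ) :
    v q = w q := by
  suffices H : v q = w q ∧ v (q + 1) = w (q + 1) ∧ v (q + 2) = w (q + 2) from H.1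
  induction q using Int.induction_on with
  | zero => exact ⟨h0, by simpa using h1, by simpa using h2⟩
  | succ i ih =>
    obtain ⟨i0, i1, i2⟩ := ih
    rw [show (i : ℤ) + 1 + 1 = i + 2 by ring]
    refine ⟨i1, i2, ?_⟩
    rw [h.eq, h'.eq, show (i : ℤ) + 1 + 1 = i + 2 by ring, add_sub_cancel_right, i0, i1, i2]
  | pred i ih =>
    obtain ⟨i0, i1, i2⟩ := ih
    rw [sub_add_cancel, show -(i : ℤ) - 1 + 2 = -i + 1 by ring]
    refine ⟨?_, i0, i1⟩
    have e := (h.eq (-i)).symm.trans (i2.trans (h'.eq (-i)))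
    rw [i0, i1] at e
    exact smul_right_injective _ (mul_pos (mul_pos (h.x_pos _) (h.y_pos _)) (h.y_pos _)).ne'
      (add_left_cancel e)

/-- Normalized lifts of the vertices of a path. -/
structure NormalizedLift (P : ℤ → RP2) (v : ℤ → Fin 3 → ℝ) (x y : ℤ → ℝ) : Prop where
  normalized : Normalized v x y
  vol_ne_zero : ∀ q, vol (v q) (v (q + 1)) (v (q + 2)) ≠ 0
  mk_eq : ∀ q (h : v q ≠ 0), P q = Projectivization.mk ℝ (v q) h

namespace NormalizedLift

variable {P : ℤ → RP2} {v : ℤ → Fin 3 → ℝ} {x y : ℤ → ℝ}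

theorem ne_zero (h : NormalizedLift P v x y) (q : ℤ) : v q ≠ 0 :=
  (ne_zero_of_vol_ne_zero (h.vol_ne_zero q)).1

theorem map (h : NormalizedLift P v x y) (g : ProjTrans) :
    NormalizedLift (fun q => g • P q) (fun q => g (v q)) x y := by
  refine ⟨h.normalized.map g.toLinearMap, fun q => ?_, fun q _ => ?_⟩
  · have := vol_map g.toLinearMap (v q) (v (q + 1)) (v (q + 2))
    simp only [LinearEquiv.coe_coe] at this
    rw [this, ← LinearEquiv.coe_det]
    exact mul_ne_zero (Units.ne_zero _) (h.vol_ne_zero q)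
  · rw [h.mk_eq q (h.ne_zero q)]; rfl

theorem exists_rep (h : NormalizedLift P v x y) :
    ∃ c : ℤ → ℝ, (∀ q, c q ≠ 0) ∧ (fun q => (P q).rep) = fun q => c q • v q := by
  have key : ∀ q, ∃ c : ℝ, c ≠ 0 ∧ (P q).rep = c • v q := by
    intro q
    have e := (P q).mk_rep.trans (h.mk_eq q (h.ne_zero q))
    obtain ⟨c, hc⟩ := (Projectivization.mk_eq_mk_iff' ℝ _ _ _ _).1 e
    refine ⟨c, ?_, hc.symm⟩
    rintro rfl
    exact (P q).rep_nonzero (by rw [← hc, zero_smul])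
  choose c hc hc' using key
  exact ⟨c, hc, funext hc'⟩

theorem invX_rep (h : NormalizedLift P v x y) (q : ℤ) : invX (fun q => (P q).rep) q = x q := by
  obtain ⟨c, hc, e⟩ := h.exists_rep
  rw [e, invX_smul hc, h.normalized.invX_eq h.vol_ne_zero]

theorem invY_rep (h : NormalizedLift P v x y) (q : ℤ) : invY (fun q => (P q).rep) q = y q := by
  obtain ⟨c, hc, e⟩ := h.exists_rep
  rw [e, invY_smul hc, h.normalized.invY_eq h.vol_ne_zero]

end NormalizedLift

/-- The coordinates of a path depend continuously on its vertices. -/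
theorem NormalizedLift.continuousAt {P : ℤ → RP2} {v : ℤ → Fin 3 → ℝ} {x y : ℤ → ℝ}
    (h : NormalizedLift P v x y) (q : ℤ) :
    ContinuousAt (fun P : ℤ → RP2 => invX (fun q => (P q).rep) q) P ∧
    ContinuousAt (fun P : ℤ → RP2 => invY (fun q => (P q).rep) q) P := by
  have hpr := IsOpenQuotientMap.piMap fun _ : ℤ => isOpenQuotientMap_mk
  set pr := Pi.map fun (_ : ℤ) (v : {v : Fin 3 → ℝ // v ≠ 0}) =>
    (Projectivization.mk ℝ v.1 v.2 : RP2)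
  have hP : P = pr fun q => ⟨v q, h.ne_zero q⟩ := funext fun q => h.mk_eq q (h.ne_zero q)
  have hrep : ∀ p : ℤ → {v : Fin 3 → ℝ // v ≠ 0}, ∃ c : ℤ → ℝ, (∀ q, c q ≠ 0) ∧
      (fun q => (pr p q).rep) = fun q => c q • (p q).1 := by
    intro p
    have key : ∀ q, ∃ c : ℝ, c ≠ 0 ∧ (pr p q).rep = c • (p q).1 := by
      intro q
      obtain ⟨c, hc⟩ := (Projectivization.mk_eq_mk_iff' ℝ _ _ (pr p q).rep_nonzero (p q).2).1
        (pr p q).mk_rep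
      refine ⟨c, ?_, hc.symm⟩
      rintro rfl
      exact (pr p q).rep_nonzero (by rw [← hc, zero_smul])
    choose c hc hc' using key
    exact ⟨c, hc, funext hc'⟩
  have hX : (fun P : ℤ → RP2 => invX (fun q => (P q).rep) q) ∘ pr
      = fun p => invX (fun q => (p q).1) q := by
    ext p
    obtain ⟨c, hc, e⟩ := hrep p
    simp only [Function.comp_apply, e]
    exact invX_smul hc _ q
  have hY : (fun P : ℤ → RP2 => invY (fun q => (P q).rep) q) ∘ pr
      = fun p => invY (fun q => (p q).1) q := by
    ext p
    obtain ⟨c, hc, e⟩ := hrep p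
    simp only [Function.comp_apply, e]
    exact invY_smul hc _ q
  have hcont : ∀ i j l : ℤ, Continuous fun p : ℤ → {v : Fin 3 → ℝ // v ≠ 0} =>
      vol (p i).1 (p j).1 (p l).1 := fun i j l =>
    continuous_vol (by fun_prop) (by fun_prop) (by fun_prop)
  have n : ∀ q, vol (v (q - 1)) (v q) (v (q + 1)) ≠ 0 := fun q => by
    have := h.vol_ne_zero (q - 1)
    rwa [sub_add_cancel, show q - 1 + 2 = q + 1 by ring] at this
  have n1 : ∀ q, vol (v (q - 1)) (v q) (v (q + 2)) ≠ 0 := fun q => by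
    rw [h.normalized.vol_skip_last]; exact n q
  have n2 : ∀ q, vol (v (q - 1)) (v (q + 1)) (v (q + 2)) ≠ 0 := fun q => by
    rw [h.normalized.vol_skip_first]; exact mul_ne_zero (h.normalized.y_pos q).ne' (n q)
  have n1' := n1 (q - 1)
  have n2' := n2 (q - 1)
  rw [show q - 1 - 1 = q - 2 by ring, show q - 1 + 2 = q + 1 by ring] at n1'
  rw [show q - 1 - 1 = q - 2 by ring, show q - 1 + 2 = q + 1 by ring, sub_add_cancel] at n2'
  rw [hP]
  constructor
  · rw [← hpr.continuousAt_comp_iff, hX]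
    unfold invX
    exact ContinuousAt.div₀ ((hcont _ _ _).mul (hcont _ _ _)).continuousAt
      ((hcont _ _ _).mul (hcont _ _ _)).continuousAt (mul_ne_zero n2' (n2 q))
  · rw [← hpr.continuousAt_comp_iff, hY]
    unfold invY
    exact ContinuousAt.div₀ ((hcont _ _ _).mul (hcont _ _ _)).continuousAt
      ((hcont _ _ _).mul (hcont _ _ _)).continuousAt (mul_ne_zero n1' (n1 q))

theorem LabeledSpiral.exists_normalizedLift {n k : ℕ} (hn : 4 ≤ n) (hk : 1 ≤ k) (hkn : k < n)
    (P : LabeledSpiral n k) : ∃ v x y, NormalizedLift P.1 v x y := by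
  obtain ⟨V, hV, hP⟩ := P.2.2.exists_spiralLift hn hk hkn
  obtain ⟨c, W, x, y, hW, hWV⟩ := hV.exists_normalizedSpiral (by lia) hk hkn
  have hWS := hV.of_posMul hkn hWV
  have hvol := fun q => hV.locallyConvex (by lia) hkn (Nat.zero_le k) q
  refine ⟨W 0, x 0, y 0, hW.normalized 0,
    fun q => (hWS.locallyConvex (by lia) hkn (Nat.zero_le k) q).ne', fun q h => ?_⟩
  have hne := (ne_zero_of_vol_ne_zero (hvol q).ne').1
  rw [hP q hne]
  exact ((hWV 0 (Nat.zero_le k) q).mk_eq h hne).symm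

/-- The coordinates are continuous on the space of spirals, and they separate its points. -/
theorem t2Space_spiralSpace {n k : ℕ} (hn : 4 ≤ n) (hk : 1 ≤ k) (hkn : k < n) :
    T2Space (SpiralSpace n k) := by
  have hex := LabeledSpiral.exists_normalizedLift hn hk hkn
  let F : LabeledSpiral n k → (ℤ → ℝ) × (ℤ → ℝ) := fun P =>
    (fun q => invX (fun q => (P.1 q).rep) q, fun q => invY (fun q => (P.1 q).rep) q)
  have hF : ∀ (P : LabeledSpiral n k) v x y, NormalizedLift P.1 v x y → F P = (x, y) :=
    fun P v x y h => Prod.ext (funext h.invX_rep) (funext h.invY_rep)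
  have hFc : Continuous F := by
    refine Continuous.prodMk (continuous_pi fun q => ?_) (continuous_pi fun q => ?_)
    · refine continuous_iff_continuousAt.2 fun P => ?_
      obtain ⟨v, x, y, h⟩ := hex P
      exact (h.continuousAt q).1.comp continuous_subtype_val.continuousAt
    · refine continuous_iff_continuousAt.2 fun P => ?_
      obtain ⟨v, x, y, h⟩ := hex P
      exact (h.continuousAt q).2.comp continuous_subtype_val.continuousAt
  have hFr : ∀ P Q : LabeledSpiral n k, P ≈ Q → F P = F Q := by
    rintro P Q ⟨g, hg⟩
    obtain ⟨v, x, y, h⟩ := hex P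
    have h' := h.map g
    rw [show (fun q => g • P.1 q) = Q.1 from funext hg] at h'
    rw [hF P _ _ _ h, hF Q _ _ _ h']
  refine T2Space.of_injective_continuous (f := Quotient.lift F hFr) ?_ (hFc.quotient_lift hFr)
  intro P Q
  induction P using Quotient.inductionOn with | _ P =>
  induction Q using Quotient.inductionOn with | _ Q =>
  intro e
  simp only [Quotient.lift_mk] at e
  obtain ⟨v, x, y, h⟩ := hex P
  obtain ⟨w, x', y', h'⟩ := hex Q
  rw [hF P _ _ _ h, hF Q _ _ _ h', Prod.mk.injEq] at e
  obtain ⟨rfl, rfl⟩ := e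
  have nv := h.vol_ne_zero 0
  have nw := h'.vol_ne_zero 0
  obtain ⟨g, g0, g1, g2⟩ := exists_linearEquiv_of_vol_ne_zero nv nw
  have key := (h.map g).normalized.ext h'.normalized g0 g1 g2
  refine Quotient.sound ⟨g, fun q => ?_⟩
  rw [(h.map g).mk_eq q ((h.map g).ne_zero q), h'.mk_eq q (h'.ne_zero q)]
  congr 1
  exact key q

/-! ### Compactness of the orbit closures -/

theorem shiftMap_zpow_mk {n k : ℕ} (m : ℤ) (P : LabeledSpiral n k) :
    (shiftMap n k ^ m) (Quotient.mk _ P) = Quotient.mk _ (LabeledSpiral.shift m P) := by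
  induction m using Int.induction_on generalizing P with
  | zero =>
    rw [zpow_zero, Equiv.Perm.one_apply]
    congr 1
    exact Subtype.ext (funext fun q => congrArg P.1 (add_zero q).symm)
  | succ i ih =>
    rw [zpow_add_one, Equiv.Perm.mul_apply]
    refine (ih (LabeledSpiral.shift 1 P)).trans ?_
    congr 1
    exact Subtype.ext (funext fun q => congrArg P.1 (by ring))
  | pred i ih =>
    rw [zpow_sub_one, Equiv.Perm.mul_apply]
    refine (ih (LabeledSpiral.shift (-1) P)).trans ?_
    congr 1
    exact Subtype.ext (funext fun q => congrArg P.1 (by ring))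

/-- For `n ≥ 4` and `1 ≤ k ≤ n - 1`, every (two-sided) orbit of the shift map has compact closure
in the space `C(n, k)`. -/
theorem theorem1p2 (n k : ℕ) (hn : 4 ≤ n) (hk : 1 ≤ k) (hkn : k ≤ n - 1)
    (c : SpiralSpace n k) :
    IsCompact (closure (Set.range fun m : ℤ => (shiftMap n k ^ m) c)) := by
  have hkn' : k < n := by lia
  have := t2Space_spiralSpace hn hk hkn'
  induction c using Quotient.inductionOn with | _ P =>
  obtain ⟨V, hV, hP⟩ := P.2.2.exists_spiralLift hn hk hkn'
  obtain ⟨ε, r, hε, hr, hz⟩ := hV.exists_boundedSpirals hn hk hkn'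
  have hne : ∀ z : boundedSpirals n k ε r, ∀ q, z.1.1 0 q ≠ 0 := fun z q =>
    (ne_zero_of_vol_ne_zero (z.2.vol_pos hε 0 q).ne').1
  -- The members of the compact family are spirals.
  let Φ : boundedSpirals n k ε r → LabeledSpiral n k := fun z =>
    ⟨fun q => Projectivization.mk ℝ (z.1.1 0 q) (hne z q),
      (z.2.spiralLift hε hr hk hkn').isPLCSpiral hn hkn' fun q => ⟨hne z q, rfl⟩,
      (z.2.spiralLift hε hr hk hkn').isGeneratedBySeed hn hk hkn' fun q => ⟨hne z q, rfl⟩⟩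
  have hΦ : Continuous Φ := by
    refine Continuous.subtype_mk (continuous_pi fun q => ?_) _
    exact isOpenQuotientMap_mk.continuous.comp
      (Continuous.subtype_mk (f := fun z : boundedSpirals n k ε r => z.1.1 0 q)
        (by fun_prop) fun z => hne z q)
  have : CompactSpace (boundedSpirals n k ε r) :=
    isCompact_iff_compactSpace.1 (isCompact_boundedSpirals n k hε r)
  have hK : IsCompact (Set.range fun z => (Quotient.mk _ (Φ z) : SpiralSpace n k)) :=
    isCompact_range (continuous_quotient_mk'.comp hΦ)
  refine hK.closure_of_subset ?_
  rintro _ ⟨m, rfl⟩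
  obtain ⟨z, hzmem, g, hg⟩ := hz m
  refine ⟨⟨z, hzmem⟩, ?_⟩
  simp only
  rw [shiftMap_zpow_mk]
  refine Eq.symm (Quotient.sound (show (spiralSetoid n k).r _ _ from ⟨g, fun q => ?_⟩))
  have hVne : V 0 (q + m) ≠ 0 := by
    obtain ⟨d, hd, e⟩ := hg q
    rintro h0
    rw [h0, map_zero, smul_zero] at e
    exact hne ⟨z, hzmem⟩ q e
  change g • P.1 (q + m) = Projectivization.mk ℝ (z.1 0 q) _
  rw [hP _ hVne, Projectivization.smul_mk]
  exact ((hg q).mk_eq _ _).symm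

end
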